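/- Let $n\ge 2$. For $\mathbb K\in\{\mathbb R,\mathbb C\}$ let $X_{\mathbb K}=\mathbb P^1_{\mathbb K}\times\mathbb P^{n-1}_{\mathbb K}\times\mathbb P^{n-1}_{\mathbb K}\subset\mathbb P(\mathbb K^2\otimes\mathbb K^n\otimes\mathbb K^n)$ be the Segre variety of decomposable tensors. The $X_{\mathbb K}$-rank of a point $f$ is the least $s$ such that $f$ lies in the linear span of $s$ points of $X_{\mathbb K}$. The generic rank of $X_{\mathbb C}$ is the rank of all points of some nonempty Zariski open set. An integer $s$ is a typical rank of $X_{\mathbb R}$ if the set of real points of $X_{\mathbb R}$-rank $s$ has nonempty interior in the Euclidean topology. Let $\mathcal R$ be the set of points of $\mathbb P(\mathbb R^2\otimes\mathbb R^n\otimes\mathbb R^n)$ whose $X_{\mathbb R}$-rank equals the generic rank of the complexification $X_{\mathbb C}$. The real rank boundary of $X_{\mathbb R}$ is the Zariski closure, in $\mathbb P(\mathbb C^2\otimes\mathbb C^n\otimes\mathbb C^n)$, of the topological boundary $\overline{\mathcal R}\setminus\operatorname{int}\mathcal R$. Then the generic rank of $X_{\mathbb C}$ is $n$, the typical ranks of $X_{\mathbb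 R}$ are exactly $n$ and $n+1$, and the real rank boundary of $X_{\mathbb R}$ equals the join of $\tau(X_{\mathbb C})$ and $\sigma_{n-2}(X_{\mathbb C})$. Here $\tau(X_{\mathbb C})$ is the tangential variety (the Zariski closure of the union of the embedded projective tangent spaces of $X_{\mathbb C}$), $\sigma_k(X_{\mathbb C})$ is the Zariski closure of the union of the linear spans of $k$ points of $X_{\mathbb C}$ (so $\sigma_0=\emptyset$), and the join of two varieties $Y,Z$ is the Zariski closure of the union of all lines through a point of $Y$ and a point of $Z$, together with $Y$ and $Z$ themselves (so the join with $\emptyset$ is the other variety; for $n=2$ the join is $\tau(X_{\mathbb C})$). -/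

import Mathlib

open scoped LinearAlgebra.Projectivization

namespace RealRank

noncomputable section

section Projective

variable {K : Type*} [Field K] {ι : Type*}

/-- The homogeneous polynomial `F` vanishes at every point of the set `S` of projective space. -/
def VanishesOn (F : MvPolynomial ι K) (S : Set (ℙ K (ι → K))) : Prop :=
  ∀ p ∈ S, MvPolynomial.eval p.rep F = 0

/-- The Zariski closure of a set of points of projective space: the common zeros of all
homogeneous polynomials that vanish on it. -/
def zariskiClosure (S : Set (ℙ K (ι → K))) : Set (ℙ K (ι → K)) :=
  {p | ∀ (F : MvPolynomial ι K) (d : ℕ), F.IsHomogeneous d → VanishesOn F S →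
    MvPolynomial.eval p.rep F = 0}

/-- The projective linear span of a set of points. -/
def linSpan (S : Set (ℙ K (ι → K))) : Set (ℙ K (ι → K)) :=
  {f | f.submodule ≤ ⨆ p ∈ S, p.submodule}

/-- The `X`-rank of `f` is `s`: the least number of distinct points of `X` whose span
contains `f` is `s`. -/
def HasRank (X : Set (ℙ K (ι → K))) (f : ℙ K (ι → K)) (s : ℕ) : Prop :=
  IsLeast {m : ℕ | ∃ S : Finset (ℙ K (ι → K)), S.card = m ∧ ↑S ⊆ X ∧ f ∈ linSpan (↑S)} s

/-- `g` is the generic `X`-rank: all points of some nonempty principal Zariski open subset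
have `X`-rank `g`. -/
def IsGenericRank (X : Set (ℙ K (ι → K))) (g : ℕ) : Prop :=
  ∃ (F : MvPolynomial ι K) (d : ℕ), F.IsHomogeneous d ∧ F ≠ 0 ∧
    ∀ f : ℙ K (ι → K), MvPolynomial.eval f.rep F ≠ 0 → HasRank X f g

/-- The affine cone over a set of points of projective space (it contains the origin). -/
def affineCone (X : Set (ℙ K (ι → K))) : Set (ι → K) :=
  {v | ∀ hv : v ≠ 0, Projectivization.mk K v hv ∈ X}

/-- The join of `Y` and `Z`: the Zariski closure of the union of all lines through a point of
`Y` and a point of `Z`. Since affine cones contain the origin, `Y` and `Z` lie in the join, and the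
join with the empty variety is the variety itself. -/
def join (Y Z : Set (ℙ K (ι → K))) : Set (ℙ K (ι → K)) :=
  zariskiClosure {f | ∃ y ∈ affineCone Y, ∃ z ∈ affineCone Z, ∃ h : y + z ≠ 0,
    f = Projectivization.mk K (y + z) h}

/-- The `k`-th secant variety of `X`: the Zariski closure of the union of the linear spans
of `k` points of `X`. It is empty for `k = 0`, and the closure of `X` for `k = 1`. -/
def secantVariety (k : ℕ) (X : Set (ℙ K (ι → K))) : Set (ℙ K (ι → K)) :=
  zariskiClosure {f | ∃ x : Fin k → ℙ K (ι → K), (∀ i, x i ∈ X) ∧ f ∈ linSpan (Set.range x)}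

/-- The embedded projective tangent space of `X` at `x`: the points killed by the differentials
at `x` of all homogeneous polynomials that vanish on `X`. -/
def tangentSpace [Fintype ι] (X : Set (ℙ K (ι → K))) (x : ℙ K (ι → K)) : Set (ℙ K (ι → K)) :=
  {y | ∀ (F : MvPolynomial ι K) (d : ℕ), F.IsHomogeneous d → VanishesOn F X →
    ∑ i, MvPolynomial.eval x.rep (MvPolynomial.pderiv i F) * y.rep i = 0}

/-- The tangential variety of a smooth projective variety `X`: the Zariski closure of the union
of its embedded projective tangent spaces. -/
def tangentialVariety [Fintype ι] (X : Set (ℙ K (ι → K))) : Set (ℙ K (ι → K)) :=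
  zariskiClosure {y | ∃ x ∈ X, y ∈ tangentSpace X x}

end Projective

section Real

variable {ι : Type*}

/-- The euclidean topology on real projective space: the quotient topology from the nonzero
vectors. -/
instance realProjectiveTopology : TopologicalSpace (ℙ ℝ (ι → ℝ)) :=
  TopologicalSpace.coinduced (Projectivization.mk' ℝ) inferInstance

/-- `s` is a typical rank of the real variety `X`: the set of points of `X`-rank `s` contains a
nonempty open set in the euclidean topology. -/
def IsTypicalRank (X : Set (ℙ ℝ (ι → ℝ))) (s : ℕ) : Prop :=
  (interior {f | HasRank X f s}).Nonempty

/-- The coordinatewise inclusion of real vectors in complex vectors. -/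
def complexifyVec : (ι → ℝ) →ₛₗ[Complex.ofRealHom] (ι → ℂ) where
  toFun v := fun i => (v i : ℂ)
  map_add' v w := by ext i; simp
  map_smul' a v := by ext i; simp

theorem complexifyVec_injective : Function.Injective (complexifyVec (ι := ι)) := by
  intro v w h
  ext i
  exact Complex.ofReal_injective (congrFun h i)

/-- The inclusion of real projective space in complex projective space. -/
def toComplex : ℙ ℝ (ι → ℝ) → ℙ ℂ (ι → ℂ) :=
  Projectivization.map complexifyVec complexifyVec_injective

/-- The complexification of a real variety, given by its real points: their complex Zariski
closure. -/
def complexification (X : Set (ℙ ℝ (ι → ℝ))) : Set (ℙ ℂ (ι → ℂ)) :=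
  zariskiClosure (toComplex '' X)

/-- The real points whose real `X`-rank is the generic rank of the complexification of `X`. -/
def genericRankLocus (X : Set (ℙ ℝ (ι → ℝ))) : Set (ℙ ℝ (ι → ℝ)) :=
  {f | ∃ g : ℕ, IsGenericRank (complexification X) g ∧ HasRank X f g}

/-- The real rank boundary: the complex Zariski closure of the topological boundary (closure
minus interior) of the locus of real points of generic rank. -/
def realRankBoundary (X : Set (ℙ ℝ (ι → ℝ))) : Set (ℙ ℂ (ι → ℂ)) :=
  zariskiClosure (toComplex '' (closure (genericRankLocus X) \ interior (genericRankLocus X)))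

end Real

section Segre

variable (K : Type*) [Field K] (n : ℕ)

/-- Coordinates of `K² ⊗ Kⁿ ⊗ Kⁿ`. -/
abbrev TensorIndex (n : ℕ) : Type := Fin 2 × Fin n × Fin n

variable {K n} in
/-- The coordinates of the decomposable tensor `a ⊗ b ⊗ c`. -/
def decomposable (a : Fin 2 → K) (b c : Fin n → K) : TensorIndex n → K :=
  fun i => a i.1 * b i.2.1 * c i.2.2

/-- The Segre variety `ℙ¹ × ℙⁿ⁻¹ × ℙⁿ⁻¹` in the projective space of `K² ⊗ Kⁿ ⊗ Kⁿ`. -/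
def segre : Set (ℙ K (TensorIndex n → K)) :=
  {p | ∃ (a : Fin 2 → K) (b c : Fin n → K) (h : decomposable a b c ≠ 0),
    p = Projectivization.mk K (decomposable a b c) h}

end Segre

end

end RealRank

/-! A tensor is a pair of `n × n` matrices `(A, B)`, and it is a sum of `m` decomposables exactly
when `A = U D W` and `B = U D' W` with common `U`, `W` and diagonal `D`, `D'` of size `m`
(`isSumOfDecomposables_iff_slice`). So fewer than `n` summands make every matrix of the pencil
singular, while a regular pencil with `n` distinct eigenvalues in the field has rank `n`. Over `ℂ`
distinct eigenvalues are generic, whence generic rank `n`.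

Over `ℝ` a generic pencil becomes diagonalizable with eigenvalues `0, …, n-1` after a rank one
change of `B`, so its rank is at most `n + 1` (`isSumOfDecomposables_succ`). Both values occur on
open sets: `n` distinct real eigenvalues persist under perturbation (`eventually_isLeast`), and a
nonreal eigenvalue violates a closed inequality valid in rank `n` (`abs_im_pow_mul_le`).

The same two facts show that at a boundary point two eigenvalues of the complex pencil, in
simultaneous triangular form, coincide (`exists_degenerate_of_mem_boundary`). The generic pencil of
this kind has one double eigenvalue with a Jordan block of size at most two: the block is a tangent
vector to the Segre variety, the remaining eigenvectors are `n - 2` decomposables, and a polynomial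
identity carries membership in the join to all degenerate pencils (`ofSlices_mem_join`).

Conversely, a generic real sum of a tangent vector and `n - 2` decomposables is a limit of tensors
of rank `n`, but its Jordan chain excludes rank `n` for itself (`joinMap_mem_boundary`). Real
parameters are Zariski dense in complex ones, so the closure of the boundary contains the whole
join. -/

namespace RealRank

open Filter
open scoped Topology

noncomputable section

/-! ### Polynomial functions and density arguments. -/

section PolynomialFunctions

variable {K : Type*} [Field K] {σ τ : Type*}

/-- A function on `K^σ` given by a polynomial. -/
def IsPolyFun (f : (σ → K) → K) : Prop :=
  ∃ P : MvPolynomial σ K, ∀ x, f x = MvPolynomial.eval x P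

namespace IsPolyFun

theorem const (a : K) : IsPolyFun (fun _ : σ → K => a) := ⟨MvPolynomial.C a, by simp⟩

theorem coord (i : σ) : IsPolyFun (fun x : σ → K => x i) := ⟨MvPolynomial.X i, by simp⟩

variable {f g : (σ → K) → K}

theorem add (hf : IsPolyFun f) (hg : IsPolyFun g) : IsPolyFun (fun x => f x + g x) := by
  obtain ⟨P, hP⟩ := hf
  obtain ⟨Q, hQ⟩ := hg
  exact ⟨P + Q, fun x => by simp [hP, hQ]⟩

theorem mul (hf : IsPolyFun f) (hg : IsPolyFun g) : IsPolyFun (fun x => f x * g x) := by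
  obtain ⟨P, hP⟩ := hf
  obtain ⟨Q, hQ⟩ := hg
  exact ⟨P * Q, fun x => by simp [hP, hQ]⟩

theorem sub (hf : IsPolyFun f) (hg : IsPolyFun g) : IsPolyFun (fun x => f x - g x) := by
  obtain ⟨P, hP⟩ := hf
  obtain ⟨Q, hQ⟩ := hg
  exact ⟨P - Q, fun x => by simp [hP, hQ]⟩

theorem sum {α : Type*} {s : Finset α} {f : α → (σ → K) → K} (h : ∀ i ∈ s, IsPolyFun (f i)) :
    IsPolyFun (fun x => ∑ i ∈ s, f i x) := by
  choose! P hP using h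
  exact ⟨∑ i ∈ s, P i, fun x => by
    rw [map_sum]; exact Finset.sum_congr rfl fun i hi => hP i hi x⟩

theorem prod {α : Type*} {s : Finset α} {f : α → (σ → K) → K} (h : ∀ i ∈ s, IsPolyFun (f i)) :
    IsPolyFun (fun x => ∏ i ∈ s, f i x) := by
  choose! P hP using h
  exact ⟨∏ i ∈ s, P i, fun x => by
    rw [map_prod]; exact Finset.prod_congr rfl fun i hi => hP i hi x⟩

theorem ite {p : Prop} [Decidable p] (hf : IsPolyFun f) (hg : IsPolyFun g) :
    IsPolyFun (fun x => if p then f x else g x) := by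
  split_ifs <;> assumption

/-- The composition of a polynomial with a map all of whose coordinates are polynomial. -/
theorem comp (F : MvPolynomial τ K) {φ : (σ → K) → τ → K} (h : ∀ i, IsPolyFun (fun x => φ x i)) :
    IsPolyFun (fun x => MvPolynomial.eval (φ x) F) := by
  choose P hP using h
  refine ⟨MvPolynomial.bind₁ P F, fun x => ?_⟩
  have : φ x = fun i => MvPolynomial.eval x (P i) := funext fun i => hP i x
  change MvPolynomial.eval (φ x) F = _
  rw [this, MvPolynomial.bind₁, MvPolynomial.map_aeval, MvPolynomial.eval]
  congr 2
  ext; simp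

variable {m : Type*} [Fintype m] [DecidableEq m]

theorem det {M : (σ → K) → Matrix m m K} (h : ∀ i j, IsPolyFun (fun x => M x i j)) :
    IsPolyFun (fun x => (M x).det) := by
  simp_rw [Matrix.det_apply']
  exact sum fun s _ => mul (const _) (prod fun i _ => h _ _)

theorem adjugate {M : (σ → K) → Matrix m m K} (h : ∀ i j, IsPolyFun (fun x => M x i j)) (i j : m) :
    IsPolyFun (fun x => (M x).adjugate i j) := by
  simp_rw [Matrix.adjugate_apply]
  refine det fun k l => ?_
  simp only [Matrix.updateRow_apply]
  exact ite (const _) (h _ _)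

/-- If `f` vanishes wherever `g` does not, and `g` is not identically zero, then `f` is zero. -/
theorem eq_zero_of_generic [Infinite K] (hf : IsPolyFun f) (hg : IsPolyFun g)
    (h : ∀ x, g x ≠ 0 → f x = 0) (h0 : ∃ x, g x ≠ 0) (x : σ → K) : f x = 0 := by
  obtain ⟨P, hP⟩ := hf
  obtain ⟨Q, hQ⟩ := hg
  have hPQ : P * Q = 0 := MvPolynomial.funext fun y => by
    by_cases hy : g y = 0
    · simp [← hQ, hy]
    · simp [← hP, h y hy]
  rcases mul_eq_zero.1 hPQ with h1 | h1
  · simp [hP, h1]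
  · obtain ⟨y, hy⟩ := h0
    exact absurd (by simp [hQ, h1]) hy

theorem exists_ne_zero_and [Infinite K] (hf : IsPolyFun f) (hg : IsPolyFun g)
    (hf0 : ∃ x, f x ≠ 0) (hg0 : ∃ x, g x ≠ 0) : ∃ x, f x ≠ 0 ∧ g x ≠ 0 := by
  by_contra! h
  obtain ⟨x, hx⟩ := hf0
  exact hx (hf.eq_zero_of_generic hg (fun y hy => by_contra fun h' => hy (h y h')) hg0 x)

/-- If `f` vanishes at the real points where `g` does not, and `g` is not identically zero,
then `f` is zero. -/
theorem eq_zero_of_real_generic {f g : (σ → ℂ) → ℂ} (hf : IsPolyFun f) (hg : IsPolyFun g)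
    (h : ∀ x : σ → ℝ, g (fun i => (x i : ℂ)) ≠ 0 → f (fun i => (x i : ℂ)) = 0)
    (h0 : ∃ x, g x ≠ 0) (x : σ → ℂ) : f x = 0 := by
  obtain ⟨P, hP⟩ := hf
  obtain ⟨Q, hQ⟩ := hg
  have hPQ : P * Q = 0 := by
    refine MvPolynomial.funext_set (fun _ => Set.range ((↑) : ℝ → ℂ))
      (fun _ => Set.infinite_range_of_injective Complex.ofReal_injective) fun y hy => ?_
    choose z hz using fun i => hy i (Set.mem_univ i)
    obtain rfl : (fun i => (z i : ℂ)) = y := funext hz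
    by_cases hy : g (fun i => (z i : ℂ)) = 0
    · simp [← hQ, hy]
    · simp [← hP, h z hy]
  rcases mul_eq_zero.1 hPQ with h1 | h1
  · simp [hP, h1]
  · obtain ⟨y, hy⟩ := h0
    exact absurd (by simp [hQ, h1]) hy

theorem continuous {f : (σ → ℝ) → ℝ} (hf : IsPolyFun f) : Continuous f := by
  obtain ⟨P, hP⟩ := hf
  rw [show f = fun x => MvPolynomial.eval x P from funext hP]
  exact MvPolynomial.continuous_eval P

/-- The complement of a real hypersurface is dense. -/
theorem dense {f : (σ → ℝ) → ℝ} (hf : IsPolyFun f) (h0 : ∃ x, f x ≠ 0) :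
    Dense {x | f x ≠ 0} := by
  intro x
  obtain ⟨P, hP⟩ := hf
  obtain ⟨y, hy⟩ := h0
  -- `p` is the restriction of `f` to the line through `x` and `y`. It is nonzero at `t = 1`, so it
  -- has finitely many roots and points of the line near `x` avoid them.
  let p : Polynomial ℝ := MvPolynomial.aeval
    (fun i => Polynomial.C (x i) + Polynomial.X * Polynomial.C (y i - x i)) P
  have hp : ∀ t, p.eval t = f (fun i => x i + t * (y i - x i)) := fun t => by
    rw [hP, ← Polynomial.coe_evalRingHom]
    change (Polynomial.evalRingHom t) (MvPolynomial.aeval _ P) = _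
    rw [MvPolynomial.map_aeval, MvPolynomial.eval]
    congr 2
    · ext; simp
    · ext; simp
  have hp0 : p ≠ 0 := fun h => hy (by simpa [h] using (hp 1).symm)
  have hfin : {t | p.eval t = 0}.Finite := by
    refine (p.roots.toFinset.finite_toSet).subset fun t ht => ?_
    simpa [hp0] using ht
  have hev : ∀ᶠ t in 𝓝[≠] (0 : ℝ), p.eval t ≠ 0 := by
    have := (hfin.subset (Set.sdiff_subset (t := {0}))).isClosed.isOpen_compl.mem_nhds
      (x := (0 : ℝ)) (by simp)
    filter_upwards [nhdsWithin_le_nhds this, self_mem_nhdsWithin] with t ht ht' h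
    exact ht ⟨h, ht'⟩
  have htend : Tendsto (fun t : ℝ => fun i => x i + t * (y i - x i)) (𝓝[≠] 0) (𝓝 x) := by
    have : Continuous (fun t : ℝ => fun i => x i + t * (y i - x i)) := by fun_prop
    have h2 := this.tendsto 0
    simp only [zero_mul, add_zero] at h2
    exact h2.mono_left nhdsWithin_le_nhds
  refine mem_closure_of_tendsto htend ?_
  filter_upwards [hev] with t ht
  simpa [hp] using ht

end IsPolyFun

end PolynomialFunctions

/-! ### Zariski closures, affine cones and joins. -/

section Zariski

variable {K : Type*} [Field K] {ι : Type*}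

theorem eval_smul_of_isHomogeneous {F : MvPolynomial ι K} {d : ℕ} (hF : F.IsHomogeneous d) (t : K)
    (v : ι → K) : MvPolynomial.eval (t • v) F = t ^ d * MvPolynomial.eval v F := by
  rw [MvPolynomial.eval_eq, MvPolynomial.eval_eq, Finset.mul_sum]
  refine Finset.sum_congr rfl fun m hm => ?_
  have hd : m.degree = d := by
    have := hF (MvPolynomial.mem_support_iff.1 hm)
    rwa [Finsupp.degree_eq_weight_one]
  simp only [Pi.smul_apply, smul_eq_mul, mul_pow, Finset.prod_mul_distrib, Finset.prod_pow_eq_pow_sum]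
  rw [← hd, Finsupp.degree_apply]
  ring

theorem eval_rep_mk {F : MvPolynomial ι K} {d : ℕ} (hF : F.IsHomogeneous d) (v : ι → K)
    (hv : v ≠ 0) :
    MvPolynomial.eval (Projectivization.mk K v hv).rep F = 0 ↔ MvPolynomial.eval v F = 0 := by
  obtain ⟨a, ha⟩ := Projectivization.exists_smul_eq_mk_rep K v hv
  rw [← ha, Units.smul_def, eval_smul_of_isHomogeneous hF]
  simp

theorem subset_zariskiClosure (S : Set (ℙ K (ι → K))) : S ⊆ zariskiClosure S :=
  fun p hp _ _ _ hS => hS p hp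

theorem zariskiClosure_subset {S T : Set (ℙ K (ι → K))} (h : S ⊆ zariskiClosure T) :
    zariskiClosure S ⊆ zariskiClosure T :=
  fun _ hp F d hF hT => hp F d hF fun _ hq => h hq F d hF hT

theorem mk_mem_zariskiClosure {S : Set (ℙ K (ι → K))} {v : ι → K} {hv : v ≠ 0} :
    Projectivization.mk K v hv ∈ zariskiClosure S ↔
      ∀ (F : MvPolynomial ι K) (d : ℕ), F.IsHomogeneous d → VanishesOn F S →
        MvPolynomial.eval v F = 0 := by
  refine forall_congr' fun F => forall_congr' fun d => forall_congr' fun hF => ?_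
  rw [eval_rep_mk hF]

theorem zero_mem_affineCone (S : Set (ℙ K (ι → K))) : (0 : ι → K) ∈ affineCone S :=
  fun h => absurd rfl h

theorem smul_mem_affineCone {S : Set (ℙ K (ι → K))} {v : ι → K} (hv : v ∈ affineCone S) (t : K) :
    t • v ∈ affineCone S := by
  intro h
  have hv0 : v ≠ 0 := fun h0 => h (by simp [h0])
  have := hv hv0
  rwa [← (Projectivization.mk_eq_mk_iff' K (t • v) v h hv0).2 ⟨t, rfl⟩] at this

theorem rep_mem_affineCone {S : Set (ℙ K (ι → K))} {p : ℙ K (ι → K)} :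
    p.rep ∈ affineCone S ↔ p ∈ S := by
  constructor
  · intro h
    simpa using h p.rep_nonzero
  · intro h _
    simpa using h

/-- The homogeneous components of a polynomial vanishing on a cone vanish on it. -/
theorem eval_homogeneousComponent_eq_zero [Infinite K] {F : MvPolynomial ι K} {v : ι → K}
    (h : ∀ t : K, MvPolynomial.eval (t • v) F = 0) (d : ℕ) :
    MvPolynomial.eval v (MvPolynomial.homogeneousComponent d F) = 0 := by
  -- `p` is `t ↦ F(t v)`; its coefficients are the values at `v` of the homogeneous components of
  -- `F`.
  let p : Polynomial K := ∑ i ∈ Finset.range (F.totalDegree + 1),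
    Polynomial.monomial i (MvPolynomial.eval v (MvPolynomial.homogeneousComponent i F))
  have hp : p = 0 := Polynomial.funext fun t => by
    have := h t
    rw [← MvPolynomial.sum_homogeneousComponent F, map_sum] at this
    simp only [p, Polynomial.eval_finsetSum, Polynomial.eval_monomial, Polynomial.eval_zero]
    rw [← this]
    refine Finset.sum_congr rfl fun i _ => ?_
    rw [eval_smul_of_isHomogeneous (MvPolynomial.homogeneousComponent_isHomogeneous i F), mul_comm]
  by_cases hd : d ∈ Finset.range (F.totalDegree + 1)
  · have := congrArg (fun q => q.coeff d) hp
    simp only [p, Polynomial.finsetSum_coeff, Polynomial.coeff_monomial, Polynomial.coeff_zero]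
      at this
    rwa [Finset.sum_ite_eq' , if_pos hd] at this
  · rw [MvPolynomial.homogeneousComponent_eq_zero _ _ (by simpa [Nat.lt_succ_iff] using hd)]
    simp

/-- A polynomial that vanishes on the affine cone over `S` vanishes on the cone over the Zariski
closure of `S`. -/
theorem eval_eq_zero_of_mem_affineCone_zariskiClosure [Infinite K] {S : Set (ℙ K (ι → K))}
    {F : MvPolynomial ι K} (h : ∀ v ∈ affineCone S, MvPolynomial.eval v F = 0) {v : ι → K}
    (hv : v ∈ affineCone (zariskiClosure S)) : MvPolynomial.eval v F = 0 := by
  by_cases hv0 : v = 0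
  · exact hv0 ▸ h 0 (zero_mem_affineCone S)
  rw [← MvPolynomial.sum_homogeneousComponent F, map_sum]
  refine Finset.sum_eq_zero fun d _ => ?_
  refine mk_mem_zariskiClosure.1 (hv hv0) _ d
    (MvPolynomial.homogeneousComponent_isHomogeneous d F) fun p hp => ?_
  refine eval_homogeneousComponent_eq_zero (fun t => h _ ?_) d
  exact smul_mem_affineCone (rep_mem_affineCone.2 hp) t

/-- A polynomial vanishing at all sums of points of two cones vanishes on the join of the
closures. -/
theorem join_zariskiClosure_subset [Infinite K] {Y Z T : Set (ℙ K (ι → K))} (hT0 : T.Nonempty)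
    (h : ∀ y ∈ affineCone Y, ∀ z ∈ affineCone Z, y + z ∈ affineCone (zariskiClosure T)) :
    join (zariskiClosure Y) (zariskiClosure Z) ⊆ zariskiClosure T := by
  refine zariskiClosure_subset ?_
  rintro _ ⟨y, hy, z, hz, hyz, rfl⟩
  refine mk_mem_zariskiClosure.2 fun F d hF hT => ?_
  -- Nonemptiness of `T` matters here: it excludes a nonzero constant `F`.
  have h00 : MvPolynomial.eval 0 F = 0 := by
    obtain ⟨p, hp⟩ := hT0
    simpa [hT p hp] using eval_smul_of_isHomogeneous hF 0 p.rep
  have key : ∀ y ∈ affineCone Y, ∀ z ∈ affineCone Z, MvPolynomial.eval (y + z) F = 0 := by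
    intro y hy z hz
    by_cases h0 : y + z = 0
    · rw [h0, h00]
    · exact mk_mem_zariskiClosure.1 (h y hy z hz h0) F d hF hT
  -- Closures are taken in one summand at a time. With the other summand fixed, the condition is a
  -- translate of `F`, in general inhomogeneous.
  have tr : ∀ w : ι → K, ∃ G : MvPolynomial ι K, ∀ x,
      MvPolynomial.eval (x + w) F = MvPolynomial.eval x G := fun w =>
    IsPolyFun.comp F fun i => (IsPolyFun.coord i).add (IsPolyFun.const (w i))
  have key2 : ∀ y ∈ affineCone Y, ∀ z ∈ affineCone (zariskiClosure Z),
      MvPolynomial.eval (y + z) F = 0 := by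
    intro y hy z hz
    obtain ⟨G, hG⟩ := tr y
    rw [add_comm, hG]
    exact eval_eq_zero_of_mem_affineCone_zariskiClosure
      (fun w hw => by rw [← hG, add_comm]; exact key y hy w hw) hz
  obtain ⟨G, hG⟩ := tr z
  rw [hG]
  exact eval_eq_zero_of_mem_affineCone_zariskiClosure
    (fun w hw => by rw [← hG]; exact key2 w hw z hz) hy

end Zariski

/-! ### Rank as the length of a sum of decomposable tensors. -/

section Rank

variable {K : Type*} [Field K] {n : ℕ}

/-- The tensor `v` is a sum of `m` decomposable tensors. -/
def IsSumOfDecomposables (m : ℕ) (v : TensorIndex n → K) : Prop :=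
  ∃ (a : Fin m → Fin 2 → K) (b c : Fin m → Fin n → K), v = ∑ i, decomposable (a i) (b i) (c i)

/-- A vector of the affine tangent space at `a ⊗ b ⊗ c` to the cone of decomposable tensors. -/
def tangentVec (a a' : Fin 2 → K) (b b' c c' : Fin n → K) : TensorIndex n → K :=
  decomposable a' b c + decomposable a b' c + decomposable a b c'

@[simp] theorem zero_decomposable (b c : Fin n → K) : decomposable 0 b c = 0 := by
  ext; simp [decomposable]

@[simp] theorem decomposable_zero_left (a : Fin 2 → K) (c : Fin n → K) :
    decomposable a 0 c = 0 := by
  ext; simp [decomposable]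

@[simp] theorem decomposable_zero_right (a : Fin 2 → K) (b : Fin n → K) :
    decomposable a b 0 = 0 := by
  ext; simp [decomposable]

theorem smul_decomposable (t : K) (a : Fin 2 → K) (b c : Fin n → K) :
    t • decomposable a b c = decomposable (t • a) b c := by
  ext; simp [decomposable, mul_assoc]

theorem isSumOfDecomposables_finset_sum {α : Type*} (s : Finset α) (a : α → Fin 2 → K)
    (b c : α → Fin n → K) :
    IsSumOfDecomposables s.card (∑ i ∈ s, decomposable (a i) (b i) (c i)) := by
  refine ⟨fun i => a (s.equivFin.symm i), fun i => b (s.equivFin.symm i),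
    fun i => c (s.equivFin.symm i), ?_⟩
  rw [Equiv.sum_comp s.equivFin.symm (fun i : s => decomposable (a i) (b i) (c i)),
    Finset.sum_coe_sort s (fun i => decomposable (a i) (b i) (c i))]

theorem isSumOfDecomposables_one (a : Fin 2 → K) (b c : Fin n → K) :
    IsSumOfDecomposables 1 (decomposable a b c) :=
  ⟨fun _ => a, fun _ => b, fun _ => c, by simp⟩

namespace IsSumOfDecomposables

variable {m m' : ℕ} {v w : TensorIndex n → K}

theorem smul (h : IsSumOfDecomposables m v) (t : K) : IsSumOfDecomposables m (t • v) := by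
  obtain ⟨a, b, c, rfl⟩ := h
  exact ⟨fun i => t • a i, b, c, by simp [Finset.smul_sum, smul_decomposable]⟩

theorem add (h : IsSumOfDecomposables m v) (h' : IsSumOfDecomposables m' w) :
    IsSumOfDecomposables (m + m') (v + w) := by
  obtain ⟨a, b, c, rfl⟩ := h
  obtain ⟨a', b', c', rfl⟩ := h'
  exact ⟨Fin.append a a', Fin.append b b', Fin.append c c', by simp [Fin.sum_univ_add]⟩

theorem mono (h : IsSumOfDecomposables m v) (hm : m ≤ m') : IsSumOfDecomposables m' v := by
  obtain ⟨k, rfl⟩ := Nat.exists_eq_add_of_le hm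
  have h0 : IsSumOfDecomposables k (0 : TensorIndex n → K) := ⟨0, 0, 0, by simp⟩
  simpa using h.add h0

theorem smul_iff {t : K} (ht : t ≠ 0) :
    IsSumOfDecomposables m (t • v) ↔ IsSumOfDecomposables m v :=
  ⟨fun h => by simpa [ht] using h.smul t⁻¹, fun h => h.smul t⟩

end IsSumOfDecomposables

theorem mk_mem_segre_iff {v : TensorIndex n → K} {hv : v ≠ 0} :
    Projectivization.mk K v hv ∈ segre K n ↔ ∃ a b c, v = decomposable a b c := by
  constructor
  · rintro ⟨a, b, c, h, hp⟩
    obtain ⟨t, ht⟩ := (Projectivization.mk_eq_mk_iff' K _ _ _ _).1 hp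
    exact ⟨t • a, b, c, by rw [← ht, smul_decomposable]⟩
  · rintro ⟨a, b, c, rfl⟩
    exact ⟨a, b, c, hv, rfl⟩

theorem mem_segre_iff {p : ℙ K (TensorIndex n → K)} :
    p ∈ segre K n ↔ ∃ a b c, p.rep = decomposable a b c := by
  conv_lhs => rw [← p.mk_rep]
  exact mk_mem_segre_iff

theorem isSumOfDecomposables_of_mem_linSpan {S : Finset (ℙ K (TensorIndex n → K))}
    (hS : ↑S ⊆ segre K n) {f : ℙ K (TensorIndex n → K)} (hf : f ∈ linSpan (↑S : Set _)) :
    IsSumOfDecomposables S.card f.rep := by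
  have h1 : f.rep ∈ Submodule.span K (Projectivization.rep '' (S : Set (ℙ K (TensorIndex n → K)))) := by
    have h2 : f.rep ∈ f.submodule := by
      rw [Projectivization.submodule_eq]
      exact Submodule.mem_span_singleton_self _
    have h3 := hf h2
    refine (iSup₂_le fun p hp => ?_ : _ ≤ Submodule.span K _) h3
    rw [Projectivization.submodule_eq, Submodule.span_singleton_le_iff_mem]
    exact Submodule.subset_span ⟨p, hp, rfl⟩
  obtain ⟨c, hc⟩ := (Submodule.mem_span_image_finset_iff_exists_fun K).1 h1
  have h4 : ∀ p : S, ∃ a b c, p.1.rep = decomposable a b c := fun p => mem_segre_iff.1 (hS p.2)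
  choose x y z hxyz using h4
  have h5 := isSumOfDecomposables_finset_sum Finset.univ (fun p => c p • x p) y z
  simp only [← smul_decomposable, ← hxyz] at h5
  rwa [hc, Finset.card_univ, Fintype.card_coe] at h5

theorem exists_finset_of_isSumOfDecomposables {m : ℕ} {f : ℙ K (TensorIndex n → K)}
    (h : IsSumOfDecomposables m f.rep) :
    ∃ S : Finset (ℙ K (TensorIndex n → K)), S.card ≤ m ∧ ↑S ⊆ segre K n ∧
      f ∈ linSpan (↑S : Set _) := by
  classical
  obtain ⟨a, b, c, h⟩ := h
  let T : Finset (Fin m) := {i | decomposable (a i) (b i) (c i) ≠ 0}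
  let g : T → ℙ K (TensorIndex n → K) := fun i =>
    Projectivization.mk K (decomposable (a i) (b i) (c i)) (Finset.mem_filter.1 i.2).2
  refine ⟨Finset.univ.image g, ?_, ?_, ?_⟩
  · calc _ ≤ Fintype.card T := Finset.card_image_le
      _ = T.card := Fintype.card_coe T
      _ ≤ m := by simpa using Finset.card_le_univ T
  · intro p hp
    obtain ⟨i, -, rfl⟩ := Finset.mem_image.1 (Finset.mem_coe.1 hp)
    exact mk_mem_segre_iff.2 ⟨_, _, _, rfl⟩
  · change f.submodule ≤ _
    rw [Projectivization.submodule_eq, Submodule.span_singleton_le_iff_mem, h]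
    refine Submodule.sum_mem _ fun i _ => ?_
    by_cases hi : decomposable (a i) (b i) (c i) = 0
    · rw [hi]; exact Submodule.zero_mem _
    · have hT : i ∈ T := Finset.mem_filter.2 ⟨Finset.mem_univ i, hi⟩
      refine Submodule.mem_iSup_of_mem (g ⟨i, hT⟩) (Submodule.mem_iSup_of_mem ?_ ?_)
      · exact Finset.mem_coe.2 (Finset.mem_image_of_mem g (Finset.mem_univ _))
      · exact Submodule.mem_span_singleton_self _

/-- Sums allow zero and proportional terms, whereas points are distinct. The minima agree because a
sum of `m` terms needs at most `m` points. -/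
theorem hasRank_segre_iff {f : ℙ K (TensorIndex n → K)} {s : ℕ} :
    HasRank (segre K n) f s ↔ IsLeast {m | IsSumOfDecomposables m f.rep} s := by
  constructor
  · rintro ⟨⟨S, rfl, hS, hf⟩, hmin⟩
    refine ⟨isSumOfDecomposables_of_mem_linSpan hS hf, fun m hm => ?_⟩
    obtain ⟨T, hT, hTX, hfT⟩ := exists_finset_of_isSumOfDecomposables hm
    exact (hmin ⟨T, rfl, hTX, hfT⟩).trans hT
  · rintro ⟨hs, hmin⟩
    obtain ⟨T, hT, hTX, hfT⟩ := exists_finset_of_isSumOfDecomposables hs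
    have hTs : T.card = s :=
      le_antisymm hT (hmin (isSumOfDecomposables_of_mem_linSpan hTX hfT))
    refine ⟨⟨T, hTs, hTX, hfT⟩, ?_⟩
    rintro _ ⟨S, rfl, hS, hf⟩
    exact hmin (isSumOfDecomposables_of_mem_linSpan hS hf)

end Rank

/-! ### Equations and complexification of the Segre variety. -/

section SegreEquations

variable {K : Type*} [Field K] {n : ℕ}

/-- The `2 × 2` minor exchanging the first indices of two entries. -/
def minorFst (p q : TensorIndex n) : MvPolynomial (TensorIndex n) K :=
  MvPolynomial.X p * MvPolynomial.X q -
    MvPolynomial.X (q.1, p.2) * MvPolynomial.X (p.1, q.2)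

/-- The `2 × 2` minor exchanging the second indices of two entries. -/
def minorSnd (p q : TensorIndex n) : MvPolynomial (TensorIndex n) K :=
  MvPolynomial.X p * MvPolynomial.X q -
    MvPolynomial.X (p.1, q.2.1, p.2.2) * MvPolynomial.X (q.1, p.2.1, q.2.2)

theorem minorFst_isHomogeneous (p q : TensorIndex n) :
    (minorFst p q : MvPolynomial _ K).IsHomogeneous 2 :=
  ((MvPolynomial.isHomogeneous_X K _).mul (MvPolynomial.isHomogeneous_X K _)).sub
    ((MvPolynomial.isHomogeneous_X K _).mul (MvPolynomial.isHomogeneous_X K _))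

theorem minorSnd_isHomogeneous (p q : TensorIndex n) :
    (minorSnd p q : MvPolynomial _ K).IsHomogeneous 2 :=
  ((MvPolynomial.isHomogeneous_X K _).mul (MvPolynomial.isHomogeneous_X K _)).sub
    ((MvPolynomial.isHomogeneous_X K _).mul (MvPolynomial.isHomogeneous_X K _))

theorem eval_minorFst_decomposable (p q : TensorIndex n) (a : Fin 2 → K) (b c : Fin n → K) :
    MvPolynomial.eval (decomposable a b c) (minorFst p q) = 0 := by
  simp only [minorFst, decomposable, map_sub, map_mul, MvPolynomial.eval_X]
  ring

theorem eval_minorSnd_decomposable (p q : TensorIndex n) (a : Fin 2 → K) (b c : Fin n → K) :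
    MvPolynomial.eval (decomposable a b c) (minorSnd p q) = 0 := by
  simp only [minorSnd, decomposable, map_sub, map_mul, MvPolynomial.eval_X]
  ring

theorem vanishesOn_segre_minorFst (p q : TensorIndex n) :
    VanishesOn (minorFst p q) (segre K n) := by
  intro x hx
  obtain ⟨a, b, c, h⟩ := mem_segre_iff.1 hx
  rw [h, eval_minorFst_decomposable]

theorem vanishesOn_segre_minorSnd (p q : TensorIndex n) :
    VanishesOn (minorSnd p q) (segre K n) := by
  intro x hx
  obtain ⟨a, b, c, h⟩ := mem_segre_iff.1 hx
  rw [h, eval_minorSnd_decomposable]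

/-- A nonzero tensor is decomposable if the `2 × 2` minors vanish at it. -/
theorem exists_eq_decomposable {v : TensorIndex n → K} (hv : v ≠ 0)
    (h1 : ∀ p q, MvPolynomial.eval v (minorFst p q) = 0)
    (h2 : ∀ p q, MvPolynomial.eval v (minorSnd p q) = 0) : ∃ a b c, v = decomposable a b c := by
  obtain ⟨⟨i₀, j₀, k₀⟩, h0⟩ := Function.ne_iff.1 hv
  rw [Pi.zero_apply] at h0
  simp only [minorFst, minorSnd, map_sub, map_mul, MvPolynomial.eval_X, sub_eq_zero] at h1 h2
  -- The factors are the three coordinate fibres through a nonzero entry, two of them normalized.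
  refine ⟨fun i => v (i, j₀, k₀) / v (i₀, j₀, k₀), fun j => v (i₀, j, k₀) / v (i₀, j₀, k₀),
    fun k => v (i₀, j₀, k), ?_⟩
  ext ⟨i, j, k⟩
  have e1 := h1 (i₀, j₀, k₀) (i, j, k)
  have e2 := h2 (i₀, j₀, k₀) (i₀, j, k)
  simp only [decomposable] at *
  field_simp
  linear_combination v (i₀, j₀, k₀) * e1 + v (i, j₀, k₀) * e2

theorem zariskiClosure_segre_subset {S : Set (ℙ K (TensorIndex n → K))} (hS : S ⊆ segre K n) :
    zariskiClosure S ⊆ segre K n := by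
  intro p hp
  refine mem_segre_iff.2 (exists_eq_decomposable p.rep_nonzero (fun x y => ?_) fun x y => ?_)
  · exact hp _ 2 (minorFst_isHomogeneous x y) fun q hq => vanishesOn_segre_minorFst x y q (hS hq)
  · exact hp _ 2 (minorSnd_isHomogeneous x y) fun q hq => vanishesOn_segre_minorSnd x y q (hS hq)

theorem toComplex_mk {ι : Type*} (v : ι → ℝ) (hv : v ≠ 0) :
    ∃ h, toComplex (Projectivization.mk ℝ v hv) =
      Projectivization.mk ℂ (fun i => (v i : ℂ)) h :=
  ⟨_, Projectivization.map_mk complexifyVec complexifyVec_injective v hv⟩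

theorem eval_toComplex_rep {ι : Type*} {F : MvPolynomial ι ℂ} {d : ℕ} (hF : F.IsHomogeneous d)
    (v : ι → ℝ) (hv : v ≠ 0) :
    MvPolynomial.eval (toComplex (Projectivization.mk ℝ v hv)).rep F = 0 ↔
      MvPolynomial.eval (fun i => (v i : ℂ)) F = 0 := by
  obtain ⟨h, e⟩ := toComplex_mk v hv
  rw [e, eval_rep_mk hF]

theorem ofReal_decomposable (a : Fin 2 → ℝ) (b c : Fin n → ℝ) :
    (fun i => ((decomposable a b c i : ℝ) : ℂ)) =
      decomposable (fun i => (a i : ℂ)) (fun i => (b i : ℂ)) (fun i => (c i : ℂ)) := by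
  ext; simp [decomposable]

/-- The complexification of the real Segre variety is the complex Segre variety. -/
theorem complexification_segre : complexification (segre ℝ n) = segre ℂ n := by
  refine Set.Subset.antisymm (zariskiClosure_segre_subset ?_) ?_
  · rintro _ ⟨p, hp, rfl⟩
    obtain ⟨a, b, c, h, rfl⟩ := hp
    obtain ⟨h', e⟩ := toComplex_mk _ h
    rw [e]
    exact mk_mem_segre_iff.2 ⟨_, _, _, ofReal_decomposable a b c⟩
  · rintro _ ⟨a, b, c, h, rfl⟩
    refine mk_mem_zariskiClosure.2 fun F d hF hS => ?_
    let φ : (Fin 2 ⊕ Fin n ⊕ Fin n → ℂ) → TensorIndex n → ℂ := fun x =>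
      decomposable (fun i => x (.inl i)) (fun i => x (.inr (.inl i))) (fun i => x (.inr (.inr i)))
    have hφ : ∀ i, IsPolyFun (fun x => φ x i) := fun i =>
      ((IsPolyFun.coord _).mul (IsPolyFun.coord _)).mul (IsPolyFun.coord _)
    -- Real parameters suffice by density. The extra coordinate factor covers parameters whose
    -- tensor is zero, which define no projective point.
    have hd : ∀ i, IsPolyFun (fun x => φ x i * MvPolynomial.eval (φ x) F) := fun i =>
      (hφ i).mul (IsPolyFun.comp F hφ)
    obtain ⟨i, hi⟩ := Function.ne_iff.1 h
    have := (hd i).eq_zero_of_real_generic (IsPolyFun.const 1) (fun x _ => ?_) ⟨0, one_ne_zero⟩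
      (Sum.elim a (Sum.elim b c))
    · exact (mul_eq_zero.1 this).resolve_left hi
    · have e : φ (fun i => (x i : ℂ)) = fun i => ((decomposable (fun i => x (.inl i))
        (fun i => x (.inr (.inl i))) (fun i => x (.inr (.inr i))) i : ℝ) : ℂ) :=
        (ofReal_decomposable _ _ _).symm
      by_cases h0 : decomposable (fun i => x (.inl i)) (fun i => x (.inr (.inl i)))
          (fun i => x (.inr (.inr i))) = 0
      · rw [e, h0]; simp
      · have := hS _ ⟨Projectivization.mk ℝ _ h0, mk_mem_segre_iff.2 ⟨_, _, _, rfl⟩, rfl⟩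
        rw [e, (eval_toComplex_rep hF _ h0).1 this, mul_zero]

end SegreEquations

/-! ### Tangent spaces of the Segre variety. -/

section Tangent

variable {n : ℕ}

/-- The chain rule for a polynomial along a differentiable curve. -/
theorem hasDerivAt_eval_comp {ι : Type*} [Fintype ι] (F : MvPolynomial ι ℂ) {γ : ℂ → ι → ℂ}
    {γ' : ι → ℂ} {t : ℂ} (h : ∀ i, HasDerivAt (fun s => γ s i) (γ' i) t) :
    HasDerivAt (fun s => MvPolynomial.eval (γ s) F)
      (∑ i, MvPolynomial.eval (γ t) (MvPolynomial.pderiv i F) * γ' i) t := by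
  classical
  induction F using MvPolynomial.induction_on with
  | C a => simpa using hasDerivAt_const t a
  | add p q hp hq =>
    simp only [map_add, add_mul, Finset.sum_add_distrib]
    exact hp.add hq
  | mul_X p i hp =>
    have := hp.mul (h i)
    simp only [map_mul, MvPolynomial.eval_X]
    refine this.congr_deriv ?_
    simp only [MvPolynomial.pderiv_mul, MvPolynomial.pderiv_X, map_add, map_mul,
      MvPolynomial.eval_X, add_mul, Finset.sum_add_distrib, Finset.sum_mul]
    congr 1
    · exact Finset.sum_congr rfl fun j _ => by ring
    · rw [Finset.sum_eq_single i]
      · simp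
      · intro j _ hj; simp [hj.symm]
      · simp

theorem eval_eq_zero_of_vanishesOn_segre {K : Type*} [Field K] {F : MvPolynomial (TensorIndex n) K}
    {d : ℕ} (hF : F.IsHomogeneous d) (hS : VanishesOn F (segre K n)) {a : Fin 2 → K}
    {b c : Fin n → K} (h : decomposable a b c ≠ 0) :
    MvPolynomial.eval (decomposable a b c) F = 0 :=
  (eval_rep_mk hF _ h).1 (hS _ (mk_mem_segre_iff.2 ⟨_, _, _, rfl⟩))

/-- The curve `(a + s a') ⊗ (b + s b') ⊗ (c + s c')` stays in the cone and has this vector as its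
velocity at `s = 0`; every equation of the variety vanishes along it. -/
theorem tangentVec_mem_tangentSpace {x y : ℙ ℂ (TensorIndex n → ℂ)} {a a' : Fin 2 → ℂ}
    {b b' c c' : Fin n → ℂ} (hx : x.rep = decomposable a b c)
    (hy : y.rep = tangentVec a a' b b' c c') : y ∈ tangentSpace (segre ℂ n) x := by
  intro F d hF hS
  rw [hx, hy]
  let γ : ℂ → TensorIndex n → ℂ := fun s =>
    decomposable (a + s • a') (b + s • b') (c + s • c')
  have hγ0 : γ 0 = decomposable a b c := by simp [γ]
  have hγ : ∀ i, HasDerivAt (fun s => γ s i) (tangentVec a a' b b' c c' i) 0 := by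
    intro i
    have lin : ∀ u w : ℂ, HasDerivAt (fun s : ℂ => u + s * w) w 0 := fun u w => by
      simpa using ((hasDerivAt_id (0 : ℂ)).mul_const w).const_add u
    have := ((lin (a i.1) (a' i.1)).mul (lin (b i.2.1) (b' i.2.1))).mul
      (lin (c i.2.2) (c' i.2.2))
    refine this.congr_deriv ?_
    simp [tangentVec, decomposable]
    ring
  have h1 := hasDerivAt_eval_comp F hγ
  rw [hγ0] at h1
  have hcont : Continuous γ := by
    refine continuous_pi fun i => ?_
    simp only [γ, decomposable, Pi.add_apply, Pi.smul_apply, smul_eq_mul]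
    fun_prop
  have h2 : ∀ᶠ s in 𝓝 (0 : ℂ), γ s ≠ 0 := by
    refine hcont.continuousAt.eventually_ne ?_
    rw [hγ0, ← hx]
    exact x.rep_nonzero
  have h3 : (fun s => MvPolynomial.eval (γ s) F) =ᶠ[𝓝 0] fun _ => 0 := by
    filter_upwards [h2] with s hs
    exact eval_eq_zero_of_vanishesOn_segre hF hS hs
  exact h1.unique ((hasDerivAt_const (0 : ℂ) (0 : ℂ)).congr_of_eventuallyEq h3)

theorem sum_eval_pderiv_X_mul_X {K ι : Type*} [Field K] [Fintype ι] (p q : ι) (x v : ι → K) :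
    ∑ i, MvPolynomial.eval x (MvPolynomial.pderiv i (MvPolynomial.X p * MvPolynomial.X q)) * v i =
      x p * v q + v p * x q := by
  classical
  have h : ∀ r i, MvPolynomial.eval x (MvPolynomial.pderiv i (MvPolynomial.X r)) =
      if r = i then 1 else 0 := fun r i => by
    rw [MvPolynomial.pderiv_X, Pi.single_apply]
    split_ifs <;> simp_all
  simp only [MvPolynomial.pderiv_mul, map_add, map_mul, h, MvPolynomial.eval_X, add_mul,
    Finset.sum_add_distrib, ite_mul, mul_ite, one_mul, zero_mul, mul_one, mul_zero,
    Finset.sum_ite_eq, Finset.mem_univ, if_true]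
  ring

/-- The linearized `2 × 2` minors through a nonzero entry of the base point already determine a
tangent vector from its three coordinate fibres. -/
theorem exists_eq_tangentVec {K : Type*} [Field K] {x y : ℙ K (TensorIndex n → K)}
    (hx : x ∈ segre K n) (hy : y ∈ tangentSpace (segre K n) x) :
    ∃ a a' b b' c c', y.rep = tangentVec a a' b b' c c' := by
  obtain ⟨a, b, c, h⟩ := mem_segre_iff.1 hx
  have hne := x.rep_nonzero
  rw [h] at hne
  obtain ⟨⟨i₀, j₀, k₀⟩, h0⟩ := Function.ne_iff.1 hne
  have h1 : ∀ p q, _ := fun p q =>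
    hy _ 2 (minorFst_isHomogeneous p q) (vanishesOn_segre_minorFst p q)
  have h2 : ∀ p q, _ := fun p q =>
    hy _ 2 (minorSnd_isHomogeneous p q) (vanishesOn_segre_minorSnd p q)
  rw [h] at h1 h2
  generalize y.rep = v at *
  simp only [minorFst, minorSnd, map_sub, sub_mul, Finset.sum_sub_distrib,
    sum_eval_pderiv_X_mul_X, decomposable] at h1 h2
  simp only [decomposable, Pi.zero_apply, ne_eq, mul_eq_zero, not_or] at h0
  obtain ⟨⟨ha, hb⟩, hc⟩ := h0
  -- Each of the three fibres contains the pivot entry `v (i₀, j₀, k₀)`; the term with factor `2`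
  -- removes the two surplus copies.
  refine ⟨a, fun i => v (i, j₀, k₀) / (b j₀ * c k₀) - 2 * v (i₀, j₀, k₀) * a i
      / (a i₀ * b j₀ * c k₀), b, fun j => v (i₀, j, k₀) / (a i₀ * c k₀), c,
    fun k => v (i₀, j₀, k) / (a i₀ * b j₀), ?_⟩
  ext ⟨i, j, k⟩
  have e1 := h1 (i₀, j₀, k₀) (i, j, k)
  have e2 := h2 (i₀, j₀, k₀) (i₀, j, k)
  simp only [tangentVec, decomposable, Pi.add_apply] at *
  field_simp
  apply mul_left_cancel₀ ha
  linear_combination a i₀ * e1 + a i * e2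

end Tangent

/-! ### Tensors as matrix pencils. -/

section Slices

variable {K : Type*} {n : ℕ}

/-- The two matrices of the pencil given by a tensor. -/
def slice (v : TensorIndex n → K) (l : Fin 2) : Matrix (Fin n) (Fin n) K :=
  Matrix.of fun j k => v (l, j, k)

@[simp] theorem slice_apply (v : TensorIndex n → K) (l : Fin 2) (j k : Fin n) :
    slice v l j k = v (l, j, k) := rfl

variable [Field K]

theorem mul_diagonal_mul_apply {m : ℕ} (U : Matrix (Fin n) (Fin m) K) (W : Matrix (Fin m) (Fin n) K)
    (p : Fin m → K) (j k : Fin n) :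
    (U * Matrix.diagonal p * W) j k = ∑ i, p i * U j i * W i k := by
  rw [Matrix.mul_apply]
  exact Finset.sum_congr rfl fun i _ => by rw [Matrix.mul_diagonal]; ring

theorem smul_add_smul_mul_diagonal_mul {m : ℕ} (U : Matrix (Fin n) (Fin m) K)
    (W : Matrix (Fin m) (Fin n) K) (p q : Fin m → K) (α β : K) :
    α • (U * Matrix.diagonal p * W) + β • (U * Matrix.diagonal q * W) =
      U * Matrix.diagonal (α • p + β • q) * W := by
  ext j k
  simp only [Matrix.add_apply, Matrix.smul_apply, mul_diagonal_mul_apply, smul_eq_mul,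
    Finset.mul_sum, ← Finset.sum_add_distrib, Pi.add_apply, Pi.smul_apply]
  exact Finset.sum_congr rfl fun i _ => by ring

theorem isSumOfDecomposables_iff_slice {m : ℕ} {v : TensorIndex n → K} :
    IsSumOfDecomposables m v ↔ ∃ (p q : Fin m → K) (U : Matrix (Fin n) (Fin m) K)
      (W : Matrix (Fin m) (Fin n) K), slice v 0 = U * Matrix.diagonal p * W ∧
        slice v 1 = U * Matrix.diagonal q * W := by
  constructor
  · rintro ⟨a, b, c, rfl⟩
    refine ⟨fun i => a i 0, fun i => a i 1, Matrix.of fun j i => b i j, Matrix.of c, ?_, ?_⟩ <;>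
    · ext j k
      simp [mul_diagonal_mul_apply, decomposable, Finset.sum_apply]
  · rintro ⟨p, q, U, W, h0, h1⟩
    refine ⟨fun i => ![p i, q i], fun i j => U j i, W, ?_⟩
    ext ⟨l, j, k⟩
    have e0 := congrFun (congrFun h0 j) k
    have e1 := congrFun (congrFun h1 j) k
    rw [mul_diagonal_mul_apply] at e0 e1
    fin_cases l <;> simpa [decomposable, Finset.sum_apply] using by assumption

/-- A tensor of rank less than `n` spans a pencil of singular matrices. -/
theorem det_pencil_eq_zero {m : ℕ} {v : TensorIndex n → K} (h : IsSumOfDecomposables m v)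
    (hm : m < n) (α β : K) : (α • slice v 0 + β • slice v 1).det = 0 := by
  obtain ⟨p, q, U, W, e0, e1⟩ := isSumOfDecomposables_iff_slice.1 h
  have h0 : α • slice v 0 + β • slice v 1 = U * Matrix.diagonal (α • p + β • q) * W := by
    rw [e0, e1]
    exact smul_add_smul_mul_diagonal_mul U W p q α β
  by_contra hd
  have h1 := Matrix.rank_of_isUnit _ ((Matrix.isUnit_iff_isUnit_det _).2 (Ne.isUnit hd))
  have h2 := (Matrix.rank_mul_le_right (U * Matrix.diagonal (α • p + β • q)) W).trans (Matrix.rank_le_card_height W)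
  rw [← h0, h1] at h2
  simp at h2
  omega

end Slices

/-! ### Diagonal, triangular and Jordan forms of pencils. -/

section Pencils

variable {K : Type*} [Field K] {n : ℕ}

/-- The kernel vectors are eigenvectors of `A⁻¹ B` for distinct eigenvalues, hence the columns of an
invertible `X`; then `U = A X` and `W = X⁻¹`. -/
theorem exists_mul_eq_mul_diagonal {A B : Matrix (Fin n) (Fin n) K} (hA : A.det ≠ 0)
    {r : Fin n → K} (hr : Function.Injective r) (h : ∀ i, (r i • A - B).det = 0) :
    ∃ U W : Matrix (Fin n) (Fin n) K, A = U * W ∧ B = U * Matrix.diagonal r * W := by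
  have hA' : IsUnit A.det := hA.isUnit
  have h1 : ∀ i, ∃ x, x ≠ 0 ∧ (r i • A - B).mulVec x = 0 := fun i =>
    Matrix.exists_mulVec_eq_zero_iff.2 (h i)
  choose x hx0 hx using h1
  have hBx : ∀ i, B.mulVec (x i) = r i • A.mulVec (x i) := fun i => by
    have := hx i
    rw [Matrix.sub_mulVec, Matrix.smul_mulVec, sub_eq_zero] at this
    exact this.symm
  have hli : LinearIndependent K x := by
    refine Module.End.eigenvectors_linearIndependent' (Matrix.toLin' (A⁻¹ * B)) r hr x fun i => ?_
    rw [Module.End.hasEigenvector_iff, Module.End.mem_eigenspace_iff]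
    refine ⟨?_, hx0 i⟩
    rw [Matrix.toLin'_apply, ← Matrix.mulVec_mulVec, hBx, Matrix.mulVec_smul,
      Matrix.mulVec_mulVec, Matrix.nonsing_inv_mul _ hA', Matrix.one_mulVec]
  let X : Matrix (Fin n) (Fin n) K := Matrix.of fun j i => x i j
  have hX : IsUnit X.det := by
    rw [← Matrix.isUnit_iff_isUnit_det, ← Matrix.linearIndependent_cols_iff_isUnit]
    exact hli
  refine ⟨A * X, X⁻¹, ?_, ?_⟩
  · rw [Matrix.mul_assoc, Matrix.mul_nonsing_inv _ hX, Matrix.mul_one]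
  · have : A * X * Matrix.diagonal r = B * X := by
      ext j i
      rw [Matrix.mul_diagonal]
      have := congrFun (hBx i) j
      simp only [Matrix.mulVec, dotProduct, Pi.smul_apply, smul_eq_mul] at this
      simp only [Matrix.mul_apply, X, Matrix.of_apply, this, mul_comm]
    rw [this, Matrix.mul_assoc, Matrix.mul_nonsing_inv _ hX, Matrix.mul_one]

/-- The matrix with first column `(α, 0)`, first row `(α, r)` and remaining block `M`. -/
def bordered (α : K) (r : Fin n → K) (M : Matrix (Fin n) (Fin n) K) :
    Matrix (Fin (n + 1)) (Fin (n + 1)) K :=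
  Matrix.of (Fin.cons (Fin.cons α r) fun i => Fin.cons 0 (M i))

theorem bordered_mul (α β : K) (r s : Fin n → K) (M N : Matrix (Fin n) (Fin n) K) :
    bordered α r M * bordered β s N =
      bordered (α * β) (α • s + Matrix.vecMul r N) (M * N) := by
  ext i j
  rw [Matrix.mul_apply, Fin.sum_univ_succ]
  refine Fin.cases ?_ (fun i => ?_) i <;> refine Fin.cases ?_ (fun j => ?_) j <;>
    simp [bordered, Matrix.mul_apply, Matrix.vecMul, dotProduct]

theorem det_bordered_one (M : Matrix (Fin n) (Fin n) K) : (bordered 1 0 M).det = M.det := by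
  rw [Matrix.det_succ_column_zero, Fin.sum_univ_succ]
  simp [bordered, Matrix.submatrix]
  rfl

theorem eq_bordered {M : Matrix (Fin (n + 1)) (Fin (n + 1)) K} (h : ∀ i : Fin n, M i.succ 0 = 0) :
    M = bordered (M 0 0) (fun j => M 0 j.succ) (M.submatrix Fin.succ Fin.succ) := by
  ext i j
  refine Fin.cases ?_ (fun i => ?_) i <;> refine Fin.cases ?_ (fun j => ?_) j <;>
    simp [bordered, h]

theorem exists_det_ne_zero_mulVec_single {x : Fin (n + 1) → K} (hx : x ≠ 0) :
    ∃ X : Matrix (Fin (n + 1)) (Fin (n + 1)) K, X.det ≠ 0 ∧ X.mulVec (Pi.single 0 1) = x := by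
  obtain ⟨j, hj⟩ := Function.ne_iff.1 hx
  refine ⟨((1 : Matrix _ _ K).updateCol j x).submatrix id (Equiv.swap 0 j), ?_, ?_⟩
  · rw [Matrix.det_permute', ← Matrix.cramer_apply, Matrix.cramer_one]
    simp only [Module.End.one_apply]
    exact mul_ne_zero (by
      rcases Int.units_eq_one_or (Equiv.Perm.sign (Equiv.swap 0 j)) with h | h <;> simp [h]) hj
  · ext i
    simp

/-- Over an algebraically closed field some line is mapped into a common line by both matrices. -/
theorem exists_mulVec_eq_smul [IsAlgClosed K] (A B : Matrix (Fin (n + 1)) (Fin (n + 1)) K) :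
    ∃ (x y : Fin (n + 1) → K) (α β : K), x ≠ 0 ∧ y ≠ 0 ∧ A.mulVec x = α • y ∧
      B.mulVec x = β • y := by
  by_cases hA : A.det = 0
  · obtain ⟨x, hx, hAx⟩ := Matrix.exists_mulVec_eq_zero_iff.2 hA
    by_cases hB : B.mulVec x = 0
    · exact ⟨x, x, 0, 0, hx, hx, by simp [hAx], by simp [hB]⟩
    · exact ⟨x, B.mulVec x, 0, 1, hx, hB, by simp [hAx], by simp⟩
  · obtain ⟨μ, hμ⟩ := Module.End.exists_eigenvalue (Matrix.toLin' (A⁻¹ * B))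
    obtain ⟨x, hx⟩ := hμ.exists_hasEigenvector
    have h1 := hx.apply_eq_smul
    rw [Matrix.toLin'_apply] at h1
    have hBx : B.mulVec x = μ • A.mulVec x := by
      rw [← Matrix.mulVec_smul, ← h1, Matrix.mulVec_mulVec, ← Matrix.mul_assoc,
        Matrix.mul_nonsing_inv _ (Ne.isUnit hA), Matrix.one_mul]
    refine ⟨x, A.mulVec x, 1, μ, hx.2, fun h => hx.2 ?_, by simp, hBx⟩
    exact Matrix.eq_zero_of_mulVec_eq_zero hA h

/-- Two matrices over an algebraically closed field can be triangularized simultaneously by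
multiplication on both sides with invertible matrices. -/
theorem exists_simultaneous_triangular [IsAlgClosed K] (A B : Matrix (Fin n) (Fin n) K) :
    ∃ Q Z S T : Matrix (Fin n) (Fin n) K, Q.det ≠ 0 ∧ Z.det ≠ 0 ∧ S.IsUpperTriangular ∧
      T.IsUpperTriangular ∧ A = Q * S * Z ∧ B = Q * T * Z := by
  induction n with
  | zero =>
    exact ⟨1, 1, A, B, by simp, by simp, fun i => i.elim0, fun i => i.elim0, by simp, by simp⟩
  | succ n ih =>
    obtain ⟨x, y, α, β, hx, hy, hA, hB⟩ := exists_mulVec_eq_smul A B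
    obtain ⟨X, hX, rfl⟩ := exists_det_ne_zero_mulVec_single hx
    obtain ⟨Y, hY, rfl⟩ := exists_det_ne_zero_mulVec_single hy
    -- Both matrices send the line of `x` into the line of `y`. In bases starting with `x` and `y`
    -- their first columns vanish below the top entry, which leaves a pair of smaller blocks.
    have red : ∀ (C : Matrix (Fin (n + 1)) (Fin (n + 1)) K) (γ : K),
        C.mulVec (X.mulVec (Pi.single 0 1)) = γ • Y.mulVec (Pi.single 0 1) →
        ∃ (γ : K) (r : Fin n → K) (D : Matrix (Fin n) (Fin n) K), C = Y * bordered γ r D * X⁻¹ := by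
      intro C γ h
      have h0 : ∀ i : Fin n, (Y⁻¹ * C * X) i.succ 0 = 0 := fun i => by
        have h1 : (Y⁻¹ * C * X).mulVec (Pi.single 0 1) = γ • Pi.single 0 1 := by
          rw [← Matrix.mulVec_mulVec, ← Matrix.mulVec_mulVec, h, Matrix.mulVec_smul,
            Matrix.mulVec_mulVec, Matrix.nonsing_inv_mul _ (Ne.isUnit hY), Matrix.one_mulVec]
        simpa using congrFun h1 i.succ
      refine ⟨(Y⁻¹ * C * X) 0 0, fun j => (Y⁻¹ * C * X) 0 j.succ,
        (Y⁻¹ * C * X).submatrix Fin.succ Fin.succ, ?_⟩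
      rw [← eq_bordered h0, Matrix.mul_assoc, Matrix.mul_assoc, Matrix.mul_assoc,
        Matrix.mul_nonsing_inv _ (Ne.isUnit hX), Matrix.mul_one, ← Matrix.mul_assoc,
        Matrix.mul_nonsing_inv _ (Ne.isUnit hY), Matrix.one_mul]
    obtain ⟨γ, r, A', rfl⟩ := red A α hA
    obtain ⟨δ, s, B', rfl⟩ := red B β hB
    obtain ⟨Q, Z, S, T, hQ, hZ, hS, hT, rfl, rfl⟩ := ih A' B'
    have tri : ∀ (γ : K) r (D : Matrix (Fin n) (Fin n) K), D.IsUpperTriangular →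
        (bordered γ r D).IsUpperTriangular := by
      intro γ r D hD i j hij
      revert hij
      refine Fin.cases ?_ (fun i => ?_) i <;> refine Fin.cases ?_ (fun j => ?_) j <;>
        intro hij
      · exact absurd hij (lt_irrefl _)
      · exact absurd hij (by simp)
      · simp [bordered]
      · simpa [bordered] using hD (Fin.succ_lt_succ_iff.1 hij)
    have fac : ∀ (γ : K) r (D : Matrix (Fin n) (Fin n) K), bordered γ r (Q * D * Z) =
        bordered 1 0 Q * bordered γ (Matrix.vecMul r Z⁻¹) D * bordered 1 0 Z := by
      intro γ r D
      rw [bordered_mul, bordered_mul]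
      simp [Matrix.vecMul_vecMul, Matrix.nonsing_inv_mul _ (Ne.isUnit hZ)]
    refine ⟨Y * bordered 1 0 Q, bordered 1 0 Z * X⁻¹, _, _, ?_, ?_, tri γ (Matrix.vecMul r Z⁻¹) S hS,
      tri δ (Matrix.vecMul s Z⁻¹) T hT, ?_, ?_⟩
    · rw [Matrix.det_mul, det_bordered_one]
      exact mul_ne_zero hY hQ
    · rw [Matrix.det_mul, det_bordered_one, Matrix.det_nonsing_inv]
      exact mul_ne_zero hZ (by simpa using hX)
    · rw [fac]; simp only [Matrix.mul_assoc]
    · rw [fac]; simp only [Matrix.mul_assoc]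

/-- A matrix with exactly one double eigenvalue is similar to a diagonal matrix with at most one
additional nonzero entry. -/
theorem exists_mul_eq_mul_diagonal_add_single {M : Matrix (Fin n) (Fin n) K} {μ : Fin n → K}
    (hM : M.charpoly = ∏ k, (Polynomial.X - Polynomial.C (μ k))) {i₀ j₀ : Fin n} (hij : i₀ ≠ j₀)
    (hμ : μ i₀ = μ j₀) (hinj : ∀ k l, k ≠ j₀ → l ≠ j₀ → μ k = μ l → k = l) :
    ∃ (P : Matrix (Fin n) (Fin n) K) (c : K), P.det ≠ 0 ∧
      M * P = P * (Matrix.diagonal μ + Matrix.single i₀ j₀ c) := by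
  classical
  set f : Module.End K (Fin n → K) := Matrix.toLin' M with hf
  have hfchar : f.charpoly = ∏ k, (Polynomial.X - Polynomial.C (μ k)) := by
    rw [hf, Matrix.charpoly_toLin', hM]
  have hev : ∀ k, f.HasEigenvalue (μ k) := fun k => by
    rw [Module.End.hasEigenvalue_iff_isRoot_charpoly, hfchar, Polynomial.IsRoot,
      Polynomial.eval_prod]
    exact Finset.prod_eq_zero (Finset.mem_univ k) (by simp)
  choose v hv using fun k => (hev k).exists_hasEigenvector
  set y := v i₀ with hy
  set N := f - μ i₀ • (1 : Module.End K (Fin n → K)) with hN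
  have hNy : N y = 0 := by
    simp [hN, hy, (hv i₀).apply_eq_smul]
  -- The double root gives a generalized eigenspace larger than the line of `y`. The last iterate
  -- under `N` of a vector `w` outside this line that is still outside it is the second vector `x`
  -- of the Jordan chain.
  have hdim : 2 ≤ Module.finrank K (f.maxGenEigenspace (μ i₀)) := by
    rw [LinearMap.finrank_maxGenEigenspace_eq, hfchar, Polynomial.le_rootMultiplicity_iff
      (Finset.prod_ne_zero_iff.2 fun k _ => Polynomial.X_sub_C_ne_zero _)]
    rw [← Finset.mul_prod_erase _ _ (Finset.mem_univ i₀),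
      ← Finset.mul_prod_erase _ _ (Finset.mem_erase.2 ⟨hij.symm, Finset.mem_univ j₀⟩), ← hμ,
      ← mul_assoc, ← sq]
    exact dvd_mul_right _ _
  obtain ⟨w, hw, hwy⟩ : ∃ w ∈ f.maxGenEigenspace (μ i₀), w ∉ Submodule.span K {y} := by
    by_contra! hle
    have h1 := Submodule.finrank_mono (show f.maxGenEigenspace (μ i₀) ≤ _ from hle)
    have h2 := finrank_span_le_card (R := K) ({y} : Set (Fin n → K))
    simp at h2
    omega
  obtain ⟨k, hk⟩ := Module.End.mem_maxGenEigenspace f (μ i₀) w |>.1 hw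
  have hex : ∃ k, (N ^ k) w ∈ Submodule.span K {y} := ⟨k, by rw [hN, hk]; exact zero_mem _⟩
  obtain ⟨x, hxy, hNx⟩ : ∃ x, x ∉ Submodule.span K {y} ∧ N x ∈ Submodule.span K {y} := by
    have hpos : Nat.find hex ≠ 0 := fun h0 => hwy (by simpa [h0] using Nat.find_spec hex)
    obtain ⟨m, hm⟩ := Nat.exists_eq_succ_of_ne_zero hpos
    refine ⟨(N ^ m) w, Nat.find_min hex (by omega), ?_⟩
    have := Nat.find_spec hex
    rwa [hm, Nat.succ_eq_add_one, pow_succ', Module.End.mul_apply] at this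
  obtain ⟨c, hc⟩ := Submodule.mem_span_singleton.1 hNx
  let p : Fin n → Fin n → K := Function.update v j₀ x
  have hpj : p j₀ = x := by simp [p]
  have hpv : ∀ k, k ≠ j₀ → p k = v k := fun k hk => by simp [p, hk]
  have hfp : ∀ k, k ≠ j₀ → f (p k) = μ k • p k := fun k hk => by
    rw [hpv k hk]; exact (hv k).apply_eq_smul
  have hfx : f x = μ j₀ • x + c • y := by
    rw [hc, ← hμ, hN]; simp
  have hsub : LinearIndependent K (fun k : {k // k ≠ j₀} => v k) :=
    Module.End.eigenvectors_linearIndependent' f (fun k : {k // k ≠ j₀} => μ k)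
      (fun k l h => Subtype.ext (hinj k l k.2 l.2 h)) _ fun k => hv k
  have hli : LinearIndependent K p := by
    rw [Fintype.linearIndependent_iff] at hsub ⊢
    intro g hg
    have hsplit : ∀ F : Fin n → (Fin n → K), ∑ k, F k = F j₀ + ∑ k : {k // k ≠ j₀}, F k := fun F => by
      rw [← Finset.add_sum_erase _ _ (Finset.mem_univ j₀)]
      congr 1
      exact (Finset.sum_subtype _ (by simp) _)
    -- Applying `N` to the relation turns `x` into `c • y`, leaving a relation among eigenvectors
    -- with distinct eigenvalues.
    have h1 : ∑ k : {k // k ≠ j₀}, (g k * (μ k - μ i₀) + if (k : Fin n) = i₀ then g j₀ * c else 0) • v k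
        = 0 := by
      have h2 := congrArg N hg
      rw [map_sum, hsplit, map_zero] at h2
      rw [← h2]
      simp only [add_smul, Finset.sum_add_distrib, ite_smul, zero_smul]
      rw [add_comm]
      congr 1
      · rw [Finset.sum_eq_single ⟨i₀, hij⟩]
        · rw [hpj, map_smul, ← hc, if_pos rfl, smul_smul]
        · intro b _ hb
          rw [if_neg fun h => hb (Subtype.ext h)]
        · simp
      · refine Finset.sum_congr rfl fun k _ => ?_
        rw [map_smul, mul_smul, hN, LinearMap.sub_apply, hfp k k.2, hpv k k.2]
        simp [sub_smul]
    have h3 : ∀ k, k ≠ j₀ → k ≠ i₀ → g k = 0 := fun k hk hki => by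
      have := hsub _ h1 ⟨k, hk⟩
      simp only [hki, if_false, add_zero] at this
      refine (mul_eq_zero.1 this).resolve_right fun h => hki ?_
      exact hinj k i₀ hk hij (sub_eq_zero.1 h)
    have h4 : g j₀ • x + g i₀ • y = 0 := by
      rw [hsplit, Finset.sum_eq_single ⟨i₀, hij⟩, hpj, hpv i₀ hij] at hg
      · exact hg
      · intro b _ hb
        rw [h3 b b.2 fun h => hb (Subtype.ext h), zero_smul]
      · simp
    have h5 : g j₀ = 0 := by
      by_contra h
      refine hxy (Submodule.mem_span_singleton.2 ⟨-(g j₀)⁻¹ * g i₀, ?_⟩)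
      have : x = (g j₀)⁻¹ • (g j₀ • x) := by rw [smul_smul, inv_mul_cancel₀ h, one_smul]
      rw [this, eq_neg_of_add_eq_zero_left h4, smul_neg, smul_smul, neg_mul, neg_smul]
    have h6 : g i₀ = 0 := by
      rw [h5, zero_smul, zero_add] at h4
      exact (smul_eq_zero.1 h4).resolve_right (hv i₀).2
    intro k
    by_cases hk : k = j₀
    · rw [hk, h5]
    by_cases hki : k = i₀
    · rw [hki, h6]
    exact h3 k hk hki
  refine ⟨Matrix.of fun j i => p i j, c, ?_, ?_⟩
  · rw [← isUnit_iff_ne_zero, ← Matrix.isUnit_iff_isUnit_det,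
      ← Matrix.linearIndependent_cols_iff_isUnit]
    exact hli
  · ext j k
    have h1 : (M * Matrix.of fun j i => p i j) j k = f (p k) j := by
      simp [hf, Matrix.mul_apply, Matrix.mulVec, dotProduct]
    rw [h1, Matrix.mul_add, Matrix.add_apply, Matrix.mul_diagonal]
    by_cases hk : k = j₀
    · subst hk
      rw [hpj, hfx, Matrix.mul_single_apply_same]
      simp [hpj, hpv i₀ hij, hy, mul_comm]
    · rw [hfp k hk, Matrix.mul_single_apply_of_ne _ _ _ _ _ hk]
      simp [mul_comm]

end Pencils

/-! ### Tensors built from their slices. -/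

section OfSlices

variable {K : Type*} {n : ℕ}

/-- The tensor with given slices. -/
def ofSlices (A B : Matrix (Fin n) (Fin n) K) : TensorIndex n → K :=
  fun i => ![A, B] i.1 i.2.1 i.2.2

@[simp] theorem slice_ofSlices_zero (A B : Matrix (Fin n) (Fin n) K) :
    slice (ofSlices A B) 0 = A := rfl

@[simp] theorem slice_ofSlices_one (A B : Matrix (Fin n) (Fin n) K) :
    slice (ofSlices A B) 1 = B := rfl

end OfSlices

/-! ### The complex generic rank. -/

section GenericRank

variable {K : Type*} [Field K] {n : ℕ}

theorem isSumOfDecomposables_of_det_eq_zero {v : TensorIndex n → K} (hA : (slice v 0).det ≠ 0)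
    {r : Fin n → K} (hr : Function.Injective r)
    (h : ∀ i, (r i • slice v 0 - slice v 1).det = 0) : IsSumOfDecomposables n v := by
  obtain ⟨U, W, h0, h1⟩ := exists_mul_eq_mul_diagonal hA hr h
  exact isSumOfDecomposables_iff_slice.2 ⟨1, r, U, W, by simpa using h0, h1⟩

theorem isLeast_of_det_ne_zero {v : TensorIndex n → K} {m : ℕ} (α β : K)
    (hA : (α • slice v 0 + β • slice v 1).det ≠ 0)
    (h : IsSumOfDecomposables m v) (hm : m ≤ n) : IsLeast {m | IsSumOfDecomposables m v} n :=
  ⟨h.mono hm, fun _ hk => not_lt.1 fun hlt => hA (det_pencil_eq_zero hk hlt α β)⟩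

/-- If the derivative of the characteristic polynomial of `M`, evaluated at `M`, is invertible,
then `M` has distinct eigenvalues. -/
theorem exists_injective_det_eq_zero [IsAlgClosed K] {M : Matrix (Fin n) (Fin n) K}
    (hM : (Polynomial.aeval M M.charpoly.derivative).det ≠ 0) :
    ∃ r : Fin n → K, Function.Injective r ∧ ∀ i, (r i • 1 - M).det = 0 := by
  classical
  have h1 : ∀ t, M.charpoly.IsRoot t → ¬ M.charpoly.derivative.IsRoot t := by
    -- A common root of the characteristic polynomial and its derivative would put an eigenvector in
    -- the kernel of the invertible matrix of `hM`.
    intro t ht ht'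
    have hev : Module.End.HasEigenvalue (Matrix.toLin' M) t := by
      rwa [Module.End.hasEigenvalue_iff_isRoot_charpoly, Matrix.charpoly_toLin']
    obtain ⟨x, hx⟩ := hev.exists_hasEigenvector
    have h2 := Module.End.aeval_apply_of_hasEigenvector (p := M.charpoly.derivative) hx
    rw [ht'.eq_zero, zero_smul] at h2
    have h3 : Polynomial.aeval (Matrix.toLin' M) M.charpoly.derivative =
        Matrix.toLin' (Polynomial.aeval M M.charpoly.derivative) :=
      Polynomial.aeval_algHom_apply (Matrix.toLinAlgEquiv' (R := K) (n := Fin n)).toAlgHom M _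
    rw [h3, Matrix.toLin'_apply] at h2
    exact hx.2 (Matrix.eq_zero_of_mulVec_eq_zero hM h2)
  have hne : M.charpoly ≠ 0 := M.charpoly_monic.ne_zero
  have hnodup : M.charpoly.roots.Nodup := by
    rw [Multiset.nodup_iff_count_le_one]
    intro t
    rw [Polynomial.count_roots]
    by_contra hlt
    have h2 := (Polynomial.one_lt_rootMultiplicity_iff_isRoot hne).1 (not_le.1 hlt)
    exact h1 t h2.1 h2.2
  have hcard : M.charpoly.roots.toFinset.card = n := by
    rw [Multiset.toFinset_card_of_nodup hnodup, IsAlgClosed.card_roots_eq_natDegree,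
      Matrix.charpoly_natDegree_eq_dim, Fintype.card_fin]
  refine ⟨fun i => (M.charpoly.roots.toFinset.equivFinOfCardEq hcard).symm i,
    Subtype.val_injective.comp (Equiv.injective _), fun i => ?_⟩
  have h2 := ((M.charpoly.roots.toFinset.equivFinOfCardEq hcard).symm i).2
  rw [Multiset.mem_toFinset, Polynomial.mem_roots hne, Polynomial.IsRoot,
    Matrix.eval_charpoly] at h2
  rwa [Matrix.scalar_apply, ← Matrix.smul_one_eq_diagonal] at h2

variable (K n) in
/-- The slices of the generic tensor. -/
def genericSlice (l : Fin 2) : Matrix (Fin n) (Fin n) (MvPolynomial (TensorIndex n) K) :=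
  Matrix.of fun j k => MvPolynomial.X (l, j, k)

variable (K n) in
/-- A polynomial whose nonvanishing implies that the pencil of a tensor is diagonalizable. -/
def genericDisc : MvPolynomial (TensorIndex n) K :=
  -- With slices `A`, `B`, the second factor is up to sign the discriminant of the characteristic
  -- polynomial of `adj(A) B`. The adjugate replaces the inverse to keep entries polynomial; it only
  -- scales the eigenvalues by `det A`.
  (genericSlice K n 0).det *
    (Polynomial.aeval ((genericSlice K n 0).adjugate * genericSlice K n 1)
      ((genericSlice K n 0).adjugate * genericSlice K n 1).charpoly.derivative).det

theorem eval_genericDisc (v : TensorIndex n → K) :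
    MvPolynomial.eval v (genericDisc K n) = (slice v 0).det *
      (Polynomial.aeval ((slice v 0).adjugate * slice v 1)
        ((slice v 0).adjugate * slice v 1).charpoly.derivative).det := by
  have hs : ∀ l, (MvPolynomial.eval v).mapMatrix (genericSlice K n l) = slice v l := fun l => by
    ext j k; simp [genericSlice]
  have hM : (MvPolynomial.eval v).mapMatrix ((genericSlice K n 0).adjugate * genericSlice K n 1) =
      (slice v 0).adjugate * slice v 1 := by
    rw [map_mul, RingHom.map_adjugate, hs, hs]
  rw [genericDisc, map_mul, RingHom.map_det, RingHom.map_det, hs,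
    Polynomial.map_aeval_eq_aeval_map (φ := MvPolynomial.eval v), hM, ← Polynomial.derivative_map,
    ← hM, ← Matrix.charpoly_map, RingHom.mapMatrix_apply]
  refine RingHom.ext fun P => ?_
  ext i j
  simp only [RingHom.comp_apply, RingHom.mapMatrix_apply, Matrix.map_apply,
    Matrix.algebraMap_matrix_apply, Algebra.algebraMap_self_apply]
  split_ifs <;> simp

theorem isSumOfDecomposables_of_eval_genericDisc [IsAlgClosed K] {v : TensorIndex n → K}
    (h : MvPolynomial.eval v (genericDisc K n) ≠ 0) : IsSumOfDecomposables n v := by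
  rw [eval_genericDisc] at h
  obtain ⟨hA, hM⟩ := mul_ne_zero_iff.1 h
  obtain ⟨r, hr, hdet⟩ := exists_injective_det_eq_zero hM
  refine isSumOfDecomposables_of_det_eq_zero hA (r := fun i => (slice v 0).det⁻¹ * r i)
    (fun i j hij => hr (mul_left_cancel₀ (inv_ne_zero hA) hij)) fun i => ?_
  have h1 : slice v 0 * (r i • 1 - (slice v 0).adjugate * slice v 1) =
      (slice v 0).det • (((slice v 0).det⁻¹ * r i) • slice v 0 - slice v 1) := by
    rw [mul_sub, ← mul_assoc, Matrix.mul_adjugate, smul_sub, smul_smul, mul_inv_cancel_left₀ hA]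
    simp
  have h2 := congrArg Matrix.det h1
  rw [Matrix.det_mul, hdet, mul_zero, Matrix.det_smul] at h2
  exact (mul_eq_zero.1 h2.symm).resolve_left (pow_ne_zero _ hA)

theorem eval_genericDisc_diagonal_ne_zero {d : Fin n → K} (hd : Function.Injective d) :
    MvPolynomial.eval (ofSlices 1 (Matrix.diagonal d)) (genericDisc K n) ≠ 0 := by
  have hdiag : ∀ p : Polynomial K, Polynomial.aeval (Matrix.diagonal d) p =
      Matrix.diagonal (fun i => p.eval (d i)) := fun p => by
    have h1 := Polynomial.aeval_algHom_apply (Matrix.diagonalAlgHom (n := Fin n) (α := K) K) d p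
    simp only [Matrix.diagonalAlgHom_apply] at h1
    rw [h1]
    congr 1
    ext i
    rw [← Polynomial.coe_aeval_eq_eval]
    exact (Polynomial.aeval_algHom_apply (Pi.evalAlgHom K (fun _ : Fin n => K) i) d p).symm
  rw [eval_genericDisc]
  simp only [slice_ofSlices_zero, slice_ofSlices_one, Matrix.det_one, Matrix.adjugate_one, one_mul]
  rw [hdiag, Matrix.det_diagonal, Finset.prod_ne_zero_iff]
  intro i _
  rw [Matrix.charpoly_diagonal, ← Polynomial.coe_aeval_eq_eval]
  refine (Polynomial.separable_prod_X_sub_C_iff.2 hd).aeval_derivative_ne_zero ?_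
  rw [map_prod]
  exact Finset.prod_eq_zero (Finset.mem_univ i) (by simp)

/-- The nonvanishing of some homogeneous component of `F` at a point implies any scale invariant
property which the nonvanishing of `F` implies. -/
theorem isGenericRank_of_polynomial [Infinite K] {g : ℕ} {F : MvPolynomial (TensorIndex n) K}
    (hF : F ≠ 0) (h : ∀ v, MvPolynomial.eval v F ≠ 0 → IsLeast {m | IsSumOfDecomposables m v} g) :
    IsGenericRank (segre K n) g := by
  obtain ⟨d, hd⟩ : ∃ d, MvPolynomial.homogeneousComponent d F ≠ 0 := by
    by_contra! h0
    exact hF (by rw [← MvPolynomial.sum_homogeneousComponent F]; simp [h0])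
  refine ⟨_, d, MvPolynomial.homogeneousComponent_isHomogeneous d F, hd, fun f hf => ?_⟩
  -- If `F` vanished at all nonzero multiples of `f.rep`, it would vanish on the whole line and so
  -- would its component of degree `d`.
  obtain ⟨t, ht0, ht⟩ : ∃ t : K, t ≠ 0 ∧ MvPolynomial.eval (t • f.rep) F ≠ 0 := by
    by_contra! h0
    have hp : IsPolyFun (fun t : Unit → K => MvPolynomial.eval (t () • f.rep) F) :=
      IsPolyFun.comp F fun i => (IsPolyFun.coord ()).mul (IsPolyFun.const (f.rep i))
    refine hf (eval_homogeneousComponent_eq_zero (fun t => ?_) d)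
    exact hp.eq_zero_of_generic (IsPolyFun.coord ()) (fun x hx => h0 _ hx) ⟨1, one_ne_zero⟩
      (fun _ => t)
  rw [hasRank_segre_iff]
  simpa only [IsSumOfDecomposables.smul_iff ht0] using h _ ht

theorem isGenericRank_segre (n : ℕ) : IsGenericRank (segre ℂ n) n := by
  refine isGenericRank_of_polynomial (F := genericDisc ℂ n) (fun h0 => ?_) fun v hv => ?_
  · refine eval_genericDisc_diagonal_ne_zero (K := ℂ) (d := fun i : Fin n => (i : ℂ)) ?_ ?_
    · exact fun i j hij => Fin.ext (Nat.cast_injective hij)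
    · rw [h0, map_zero]
  · refine isLeast_of_det_ne_zero 1 0 ?_ (isSumOfDecomposables_of_eval_genericDisc hv) le_rfl
    rw [eval_genericDisc] at hv
    simpa using left_ne_zero_of_mul hv

/-- Two nonempty principal open sets meet; the additional factor, a variable, keeps the common point
away from the origin. -/
theorem IsGenericRank.unique {ι : Type*} [Nonempty ι] [Infinite K] {X : Set (ℙ K (ι → K))} {g g' : ℕ}
    (h : IsGenericRank X g) (h' : IsGenericRank X g') : g = g' := by
  obtain ⟨F, d, hFd, hF, hFX⟩ := h
  obtain ⟨G, e, hGe, hG, hGX⟩ := h'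
  have hne : F * G * MvPolynomial.X (Classical.arbitrary ι) ≠ 0 :=
    mul_ne_zero (mul_ne_zero hF hG) (MvPolynomial.X_ne_zero _)
  obtain ⟨x, hx⟩ : ∃ x, MvPolynomial.eval x (F * G * MvPolynomial.X (Classical.arbitrary ι)) ≠ 0 := by
    by_contra! h0
    exact hne (MvPolynomial.funext fun x => by rw [h0, map_zero])
  rw [map_mul, map_mul, MvPolynomial.eval_X] at hx
  obtain ⟨⟨hFx, hGx⟩, hx0⟩ := mul_ne_zero_iff.1 hx |>.imp_left mul_ne_zero_iff.1
  have hx' : x ≠ 0 := fun h0 => hx0 (by simp [h0])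
  exact (hFX (Projectivization.mk K x hx') ((eval_rep_mk hFd x hx').not.2 hFx)).unique
    (hGX (Projectivization.mk K x hx') ((eval_rep_mk hGe x hx').not.2 hGx))

theorem genericRankLocus_segre (hn : 2 ≤ n) :
    genericRankLocus (segre ℝ n) = {f | HasRank (segre ℝ n) f n} := by
  have : Nonempty (Fin n) := ⟨⟨0, by omega⟩⟩
  ext f
  simp only [genericRankLocus, complexification_segre, Set.mem_ofPred_eq]
  exact ⟨fun ⟨g, hg, hf⟩ => (isGenericRank_segre n).unique hg ▸ hf,
    fun hf => ⟨n, isGenericRank_segre n, hf⟩⟩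

end GenericRank

/-! ### The bound `n + 1` for the rank of generic tensors. -/

section RankSucc

variable {K : Type*} [Field K] {n : ℕ}

/-- The vectors `adj(B - iA) 1`, whose independence bounds the rank of `(A, B)` by `n + 1`. -/
def poleVectors (v : TensorIndex n → K) : Matrix (Fin n) (Fin n) K :=
  Matrix.of fun j i => (slice v 1 - (i : K) • slice v 0).adjugate.mulVec 1 j

/-- This is pole placement. The `i`-th column `x` of `V = poleVectors v` satisfies `(B - iA) x =
det(B - iA) 1`, so `B` minus a rank one matrix with column vector `1` sends `x` to `i A x`, and the
corrected pencil is diagonal in the columns of `V`. -/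
theorem isSumOfDecomposables_succ {v : TensorIndex n → K} (h : (poleVectors v).det ≠ 0) :
    IsSumOfDecomposables (n + 1) v := by
  set V := poleVectors v with hV
  let d : Fin n → K := fun i => (slice v 1 - (i : K) • slice v 0).det
  let e : Fin n → K := Matrix.vecMul d V⁻¹
  have hunit : IsUnit V.det := h.isUnit
  have h1 : slice v 1 * V = slice v 0 * V * Matrix.diagonal (fun i : Fin n => (i : K)) +
      Matrix.vecMulVec 1 d := by
    ext j i
    have h2 : (slice v 1 - (i : K) • slice v 0).mulVec (fun j => V j i) j = d i := by
      have : (fun j => V j i) = (slice v 1 - (i : K) • slice v 0).adjugate.mulVec 1 := rfl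
      rw [this, Matrix.mulVec_mulVec, Matrix.mul_adjugate]
      simp [d, Matrix.smul_mulVec]
    rw [Matrix.sub_mulVec, Matrix.smul_mulVec] at h2
    have h3 : (slice v 1).mulVec (fun j => V j i) j = (slice v 1 * V) j i := rfl
    have h4 : (slice v 0).mulVec (fun j => V j i) j = (slice v 0 * V) j i := rfl
    rw [Pi.sub_apply, Pi.smul_apply, h3, h4, sub_eq_iff_eq_add] at h2
    rw [h2, Matrix.add_apply, Matrix.mul_diagonal, Matrix.vecMulVec_apply]
    simp [mul_comm, add_comm]
  have h0 : slice v 0 = slice v 0 * V * V⁻¹ := by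
    rw [Matrix.mul_assoc, Matrix.mul_nonsing_inv _ hunit, Matrix.mul_one]
  have h5 : slice v 1 = slice v 0 * V * Matrix.diagonal (fun i : Fin n => (i : K)) * V⁻¹ +
      Matrix.vecMulVec 1 e := by
    rw [← Matrix.vecMulVec_mul, ← Matrix.add_mul, ← h1, Matrix.mul_assoc,
      Matrix.mul_nonsing_inv _ hunit, Matrix.mul_one]
  let w : TensorIndex n → K :=
    ofSlices (slice v 0) (slice v 0 * V * Matrix.diagonal (fun i : Fin n => (i : K)) * V⁻¹)
  have hw : IsSumOfDecomposables n w :=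
    isSumOfDecomposables_iff_slice.2 ⟨1, fun i => (i : K), slice v 0 * V, V⁻¹, by simpa [w] using h0,
      rfl⟩
  have hvw : v = w + decomposable ![0, 1] 1 e := by
    ext ⟨l, j, k⟩
    fin_cases l
    · simp [w, ofSlices, decomposable]
    · have := congrFun (congrFun h5 j) k
      simpa [w, ofSlices, decomposable, Matrix.vecMulVec_apply] using this
  rw [hvw]
  exact hw.add (isSumOfDecomposables_one _ _ _)

theorem isPolyFun_slice (l : Fin 2) (j k : Fin n) :
    IsPolyFun (fun v : TensorIndex n → K => slice v l j k) := IsPolyFun.coord (l, j, k)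

theorem isPolyFun_det_poleVectors :
    IsPolyFun (fun v : TensorIndex n → K => (poleVectors v).det) := by
  refine IsPolyFun.det fun j i => ?_
  simp only [poleVectors, Matrix.of_apply, Matrix.mulVec, dotProduct]
  refine IsPolyFun.sum fun k _ => IsPolyFun.mul (IsPolyFun.adjugate (fun a b => ?_) _ _)
    (IsPolyFun.const _)
  exact (isPolyFun_slice 1 a b).sub ((IsPolyFun.const (i : K)).mul (isPolyFun_slice 0 a b))

theorem exists_det_poleVectors_ne_zero [CharZero K] :
    ∃ v : TensorIndex n → K, (poleVectors v).det ≠ 0 := by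
  let D : Matrix (Fin n) (Fin n) K := Matrix.diagonal fun i : Fin n => (i : K)
  -- With `A = 1` and `B = D` plus the all-ones matrix, `B - iA` sends the `i`-th basis vector to
  -- the vector `1`. Hence the pole vectors are multiples of the standard basis.
  let v : TensorIndex n → K := ofSlices 1 (D + Matrix.of fun _ _ => 1)
  let C : Fin n → Matrix (Fin n) (Fin n) K := fun i => slice v 1 - (i : K) • slice v 0
  have hC : ∀ i x j, (C i).mulVec x j = ((j : K) - i) * x j + ∑ k, x k := fun i x j => by
    simp [C, v, D, Matrix.sub_mulVec, Matrix.add_mulVec, Matrix.smul_mulVec,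
      Matrix.mulVec_diagonal]
    simp only [Matrix.mulVec, dotProduct, Matrix.of_apply, one_mul]
    ring
  have hdet : ∀ i, (C i).det ≠ 0 := fun i h0 => by
    obtain ⟨x, hx, hCx⟩ := Matrix.exists_mulVec_eq_zero_iff.2 h0
    have h1 : ∀ j : Fin n, ((j : K) - i) * x j + ∑ k, x k = 0 := fun j => by rw [← hC, hCx]; rfl
    have h2 : ∑ k, x k = 0 := by simpa using h1 i
    have h3 : ∀ j, j ≠ i → x j = 0 := fun j hj => by
      have h4 := h1 j
      rw [h2, add_zero] at h4
      refine (mul_eq_zero.1 h4).resolve_left fun h5 => hj (Fin.ext ?_)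
      exact_mod_cast sub_eq_zero.1 h5
    have h6 : x i = 0 := by
      rwa [Finset.sum_eq_single i (fun j _ hj => h3 j hj) (by simp)] at h2
    exact hx (funext fun j => if hj : j = i then hj ▸ h6 else h3 j hj)
  have hV : poleVectors v = Matrix.diagonal fun i => (C i).det := by
    ext j i
    have h1 : (1 : Fin n → K) = (C i).mulVec (Pi.single i 1) := by
      ext k
      rw [hC]
      by_cases hk : k = i <;> simp [hk]
    change (C i).adjugate.mulVec 1 j = _
    rw [h1, Matrix.mulVec_mulVec, Matrix.adjugate_mul, Matrix.smul_mulVec, Matrix.one_mulVec]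
    by_cases hj : j = i <;> simp [hj]
  refine ⟨v, ?_⟩
  rw [hV, Matrix.det_diagonal]
  exact Finset.prod_ne_zero_iff.2 fun i _ => hdet i

/-- Real tensors outside some hypersurface have rank `n` or `n + 1`. -/
theorem exists_isPolyFun_rank_le [CharZero K] : ∃ g : (TensorIndex n → K) → K, IsPolyFun g ∧
    (∃ v, g v ≠ 0) ∧ ∀ v, g v ≠ 0 → (slice v 0).det ≠ 0 ∧ IsSumOfDecomposables (n + 1) v := by
  have hp0 : IsPolyFun (fun v : TensorIndex n → K => (slice v 0).det) :=
    IsPolyFun.det (isPolyFun_slice 0)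
  refine ⟨fun v => (slice v 0).det * (poleVectors v).det, hp0.mul isPolyFun_det_poleVectors, ?_,
    fun v hv => ⟨left_ne_zero_of_mul hv, isSumOfDecomposables_succ (right_ne_zero_of_mul hv)⟩⟩
  obtain ⟨v, h1, h2⟩ := hp0.exists_ne_zero_and isPolyFun_det_poleVectors
    ⟨ofSlices 1 1, by simp⟩ exists_det_poleVectors_ne_zero
  exact ⟨v, mul_ne_zero h1 h2⟩

end RankSucc

/-! ### The Euclidean topology of real projective space. -/

section Topology

variable {ι : Type*}

theorem continuous_mk' : Continuous (Projectivization.mk' ℝ (V := ι → ℝ)) :=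
  continuous_coinduced_rng

theorem isOpenMap_mk' : IsOpenMap (Projectivization.mk' ℝ (V := ι → ℝ)) := by
  intro U hU
  refine isOpen_coinduced.2 ?_
  have h1 : Projectivization.mk' ℝ ⁻¹' (Projectivization.mk' ℝ '' U) =
      ⋃ a : ℝˣ, (fun v : {v : ι → ℝ // v ≠ 0} => (⟨a • v.1, by
        rw [Units.smul_def]; exact smul_ne_zero a.ne_zero v.2⟩ : {v : ι → ℝ // v ≠ 0})) ⁻¹' U := by
    ext v
    simp only [Set.mem_preimage, Set.mem_image, Set.mem_iUnion, Projectivization.mk'_eq_mk]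
    constructor
    · rintro ⟨w, hw, hwv⟩
      obtain ⟨a, ha⟩ := (Projectivization.mk_eq_mk_iff ℝ _ _ _ _).1 hwv
      exact ⟨a, by simpa only [ha] using hw⟩
    · rintro ⟨a, ha⟩
      exact ⟨_, ha, (Projectivization.mk_eq_mk_iff ℝ _ _ _ _).2 ⟨a, rfl⟩⟩
  rw [h1]
  refine isOpen_iUnion fun a => hU.preimage ?_
  exact (continuous_subtype_val.const_smul (a : ℝ)).subtype_mk _

variable {P : (ι → ℝ) → Prop}

theorem mk_mem_setOf_rep_iff (hP : ∀ (t : ℝ) v, t ≠ 0 → (P (t • v) ↔ P v)) (v : ι → ℝ)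
    (hv : v ≠ 0) : Projectivization.mk ℝ v hv ∈ {f : ℙ ℝ (ι → ℝ) | P f.rep} ↔ P v := by
  obtain ⟨a, ha⟩ := Projectivization.exists_smul_eq_mk_rep ℝ v hv
  rw [Set.mem_ofPred_eq, ← ha, Units.smul_def, hP _ _ a.ne_zero]

/-- The quotient map is open and continuous and the nonzero vectors form an open set, so
neighbourhoods can be tested among vectors. -/
theorem mk_mem_interior_iff [Finite ι] (hP : ∀ (t : ℝ) v, t ≠ 0 → (P (t • v) ↔ P v)) (v : ι → ℝ)
    (hv : v ≠ 0) : Projectivization.mk ℝ v hv ∈ interior {f : ℙ ℝ (ι → ℝ) | P f.rep} ↔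
      ∀ᶠ w in 𝓝 v, P w := by
  change (⟨v, hv⟩ : {v : ι → ℝ // v ≠ 0}) ∈ Projectivization.mk' ℝ ⁻¹' interior _ ↔ _
  rw [isOpenMap_mk'.preimage_interior_eq_interior_preimage continuous_mk',
    mem_interior_iff_mem_nhds]
  have h1 : map Subtype.val (𝓝 (⟨v, hv⟩ : {v : ι → ℝ // v ≠ 0})) = 𝓝 v :=
    isOpen_ne.isOpenEmbedding_subtypeVal.map_nhds_eq ⟨v, hv⟩
  rw [← h1, eventually_map]
  exact eventually_congr (Eventually.of_forall fun w => mk_mem_setOf_rep_iff hP w w.2)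

theorem mk_mem_closure_iff [Finite ι] (hP : ∀ (t : ℝ) v, t ≠ 0 → (P (t • v) ↔ P v)) (v : ι → ℝ)
    (hv : v ≠ 0) : Projectivization.mk ℝ v hv ∈ closure {f : ℙ ℝ (ι → ℝ) | P f.rep} ↔
      ∃ᶠ w in 𝓝 v, P w := by
  rw [closure_eq_compl_interior_compl, Set.mem_compl_iff]
  exact (mk_mem_interior_iff (P := fun v => ¬ P v) (fun t v ht => (hP t v ht).not) v hv).not

end Topology

/-! ### Real eigenvalues and the typical ranks. -/

section RealPencils

variable {n : ℕ}

theorem continuous_slice (l : Fin 2) : Continuous (fun v : TensorIndex n → ℝ => slice v l) :=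
  continuous_matrix fun j k => continuous_apply (l, j, k)

/-- The real rank `n` locus satisfies a closed inequality, which forces the eigenvalues of a
regular pencil to be real. -/
theorem abs_im_pow_mul_le {v : TensorIndex n → ℝ} (h : IsSumOfDecomposables n v) (α : ℝ) (z : ℂ) :
    |z.im| ^ n * |(α • slice v 0 + slice v 1).det| ≤
      ‖(z • (α • slice v 0 + slice v 1).map Complex.ofRealHom -
        (slice v 0).map Complex.ofRealHom).det‖ := by
  obtain ⟨p, q, U, W, h0, h1⟩ := isSumOfDecomposables_iff_slice.1 h
  have h2 : α • slice v 0 + slice v 1 = U * Matrix.diagonal (α • p + q) * W := by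
    have := smul_add_smul_mul_diagonal_mul U W p q α 1
    rwa [one_smul, one_smul, ← h0, ← h1] at this
  have h3 : z • (α • slice v 0 + slice v 1).map Complex.ofRealHom -
      (slice v 0).map Complex.ofRealHom = U.map Complex.ofRealHom *
        Matrix.diagonal (fun i => z * ((α * p i + q i : ℝ) : ℂ) - (p i : ℂ)) *
          W.map Complex.ofRealHom := by
    rw [h2, h0]
    ext j k
    simp only [Matrix.sub_apply, Matrix.smul_apply, Matrix.map_apply, mul_diagonal_mul_apply,
      map_sum, smul_eq_mul, Finset.mul_sum, ← Finset.sum_sub_distrib]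
    refine Finset.sum_congr rfl fun i _ => ?_
    simp
    ring
  have hU : (U.map Complex.ofRealHom).det = (U.det : ℂ) := (RingHom.map_det _ U).symm
  have hW : (W.map Complex.ofRealHom).det = (W.det : ℂ) := (RingHom.map_det _ W).symm
  rw [h3, h2, Matrix.det_mul, Matrix.det_mul, Matrix.det_mul, Matrix.det_mul, hU, hW,
    Matrix.det_diagonal, Matrix.det_diagonal, abs_mul, abs_mul, norm_mul, norm_mul, norm_prod,
    Finset.abs_prod, Complex.norm_real, Complex.norm_real, Real.norm_eq_abs, Real.norm_eq_abs]
  -- Both determinants are products over the same diagonalization; since `p` and `q` are real, each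
  -- factor is bounded below by its imaginary part.
  have h4 : |z.im| ^ n * ∏ i, |(α • p + q) i| ≤ ∏ i, ‖z * ((α * p i + q i : ℝ) : ℂ) - (p i : ℂ)‖ := by
    have h5 : |z.im| ^ n = ∏ _i : Fin n, |z.im| := by simp
    rw [h5, ← Finset.prod_mul_distrib]
    refine Finset.prod_le_prod (fun i _ => by positivity) fun i _ => ?_
    have h6 := Complex.abs_im_le_norm (z * ((α * p i + q i : ℝ) : ℂ) - (p i : ℂ))
    rw [Complex.sub_im, Complex.im_mul_ofReal, Complex.ofReal_im, sub_zero, abs_mul] at h6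
    exact h6
  calc _ = |U.det| * (|z.im| ^ n * ∏ i, |(α • p + q) i|) * |W.det| := by ring
    _ ≤ _ := by gcongr

theorem isClosed_abs_im_pow_mul_le (α : ℝ) (z : ℂ) :
    IsClosed {v : TensorIndex n → ℝ | |z.im| ^ n * |(α • slice v 0 + slice v 1).det| ≤
      ‖(z • (α • slice v 0 + slice v 1).map Complex.ofRealHom -
        (slice v 0).map Complex.ofRealHom).det‖} := by
  have h0 := continuous_slice (n := n) 0
  have h1 := continuous_slice (n := n) 1
  have h2 : Continuous (fun v : TensorIndex n → ℝ => α • slice v 0 + slice v 1) :=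
    (h0.const_smul α).add h1
  have hc : Continuous Complex.ofRealHom := Complex.continuous_ofReal
  refine isClosed_le (continuous_const.mul h2.matrix_det.abs) (Continuous.norm ?_)
  exact (((h2.matrix_map hc).const_smul z).sub (h0.matrix_map hc)).matrix_det

theorem isSumOfDecomposables_of_det_eq_zero' {K : Type*} [Field K] {v : TensorIndex n → K} {α : K}
    (hA : (α • slice v 0 + slice v 1).det ≠ 0) {r : Fin n → K} (hr : Function.Injective r)
    (h : ∀ i, (r i • (α • slice v 0 + slice v 1) - slice v 0).det = 0) :
    IsSumOfDecomposables n v := by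
  obtain ⟨U, W, h1, h0⟩ := exists_mul_eq_mul_diagonal hA hr h
  refine isSumOfDecomposables_iff_slice.2 ⟨r, (1 : K) • 1 + (-α) • r, U, W, h0, ?_⟩
  rw [← smul_add_smul_mul_diagonal_mul, ← h0, Pi.one_def, Matrix.diagonal_one, Matrix.mul_one, ← h1]
  module

/-- If a real pencil has `n` distinct real eigenvalues, so have the neighbouring ones. -/
theorem eventually_isLeast {v : TensorIndex n → ℝ} {α : ℝ}
    (hA : (α • slice v 0 + slice v 1).det ≠ 0) {ρ : Fin n → ℝ} (hρ : Function.Injective ρ)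
    (h : ∀ x : ℝ, (x • (α • slice v 0 + slice v 1) - slice v 0).det =
      (α • slice v 0 + slice v 1).det * ∏ i, (x - ρ i)) :
    ∀ᶠ w in 𝓝 v, IsLeast {m | IsSumOfDecomposables m w} n := by
  have h0 := continuous_slice (n := n) 0
  have hA' : Continuous (fun v : TensorIndex n → ℝ => α • slice v 0 + slice v 1) :=
    (h0.const_smul α).add (continuous_slice 1)
  let φ : (TensorIndex n → ℝ) → ℝ → ℝ := fun w x =>
    (x • (α • slice w 0 + slice w 1) - slice w 0).det
  have hφw : ∀ x, Continuous fun w => φ w x := fun x => ((hA'.const_smul x).sub h0).matrix_det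
  have hφx : ∀ w, Continuous (φ w) := fun w =>
    ((continuous_id.smul continuous_const).sub continuous_const).matrix_det
  -- The intervals of radius `ε` about the roots are disjoint. The determinant changes sign across
  -- each, a property stable under perturbation, so nearby pencils have one root in each interval.
  obtain ⟨ε, hε, hεpos⟩ : ∃ ε : ℝ, (∀ i j, i ≠ j → 2 * ε < |ρ i - ρ j|) ∧ 0 < ε := by
    have h1 : ∀ᶠ ε : ℝ in 𝓝[>] 0, ∀ i j, i ≠ j → 2 * ε < |ρ i - ρ j| := by
      refine nhdsWithin_le_nhds ?_
      refine eventually_all.2 fun i => eventually_all.2 fun j => ?_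
      by_cases hij : i = j
      · simp [hij]
      · have h2 : Tendsto (fun ε : ℝ => 2 * ε) (𝓝 0) (𝓝 (2 * 0)) :=
          (continuous_const.mul continuous_id).tendsto 0
        rw [mul_zero] at h2
        filter_upwards [h2.eventually_lt_const
          (abs_pos.2 (sub_ne_zero.2 (hρ.ne hij)))] with ε h3 _ using h3
    exact (h1.and self_mem_nhdsWithin).exists
  have hneg : ∀ i, φ v (ρ i - ε) * φ v (ρ i + ε) < 0 := by
    intro i
    -- Only the factor `j = i` of this product is negative.
    have h1 : φ v (ρ i - ε) * φ v (ρ i + ε) = (α • slice v 0 + slice v 1).det ^ 2 *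
        ∏ j, ((ρ i - ρ j) ^ 2 - ε ^ 2) := by
      simp only [φ, h]
      rw [mul_mul_mul_comm, ← Finset.prod_mul_distrib, sq]
      congr 1
      exact Finset.prod_congr rfl fun j _ => by ring
    rw [h1, ← Finset.mul_prod_erase _ _ (Finset.mem_univ i)]
    have h2 : 0 < ∏ j ∈ Finset.univ.erase i, ((ρ i - ρ j) ^ 2 - ε ^ 2) := by
      refine Finset.prod_pos fun j hj => ?_
      have h3 := hε i j (Finset.ne_of_mem_erase hj).symm
      rw [← sq_abs (ρ i - ρ j)]
      nlinarith
    have h3 : 0 < (α • slice v 0 + slice v 1).det ^ 2 := by positivity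
    have h4 : (ρ i - ρ i) ^ 2 - ε ^ 2 < 0 := by
      rw [sub_self]
      nlinarith
    exact mul_neg_of_pos_of_neg h3 (mul_neg_of_neg_of_pos h4 h2)
  have hev : ∀ᶠ w in 𝓝 v, ∀ i, φ w (ρ i - ε) * φ w (ρ i + ε) < 0 :=
    eventually_all.2 fun i =>
      ((hφw _).mul (hφw _)).continuousAt.eventually_lt_const (hneg i)
  filter_upwards [hev, hA'.matrix_det.continuousAt.eventually_ne hA] with w hw hwA
  have hroot : ∀ i, ∃ x, |x - ρ i| ≤ ε ∧ φ w x = 0 := by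
    intro i
    have h1 : (0 : ℝ) ∈ Set.uIcc (φ w (ρ i - ε)) (φ w (ρ i + ε)) := by
      rw [Set.mem_uIcc]
      rcases mul_neg_iff.1 (hw i) with h2 | h2
      · exact Or.inr ⟨h2.2.le, h2.1.le⟩
      · exact Or.inl ⟨h2.1.le, h2.2.le⟩
    obtain ⟨x, hx, hx0⟩ := intermediate_value_uIcc (hφx w).continuousOn h1
    rw [Set.uIcc_of_le (by linarith)] at hx
    exact ⟨x, abs_le.2 ⟨by linarith [hx.1], by linarith [hx.2]⟩, hx0⟩
  choose r hr hr0 using hroot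
  have hrinj : Function.Injective r := by
    intro i j hij
    by_contra hne
    have h1 := hε i j hne
    have h2 : |ρ i - ρ j| ≤ |r i - ρ i| + |r j - ρ j| := by
      have : ρ i - ρ j = (r j - ρ j) - (r i - ρ i) := by rw [hij]; ring
      rw [this, add_comm]
      exact abs_sub _ _
    linarith [hr i, hr j]
  refine isLeast_of_det_ne_zero α 1 (by rwa [one_smul]) ?_ le_rfl
  exact isSumOfDecomposables_of_det_eq_zero' hwA hrinj hr0

theorem isLeast_smul_iff {t : ℝ} (v : TensorIndex n → ℝ) (s : ℕ) (ht : t ≠ 0) :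
    IsLeast {m | IsSumOfDecomposables m (t • v)} s ↔ IsLeast {m | IsSumOfDecomposables m v} s := by
  simp only [IsSumOfDecomposables.smul_iff ht]

theorem setOf_hasRank (s : ℕ) : {f | HasRank (segre ℝ n) f s} =
    {f : ℙ ℝ (TensorIndex n → ℝ) | IsLeast {m | IsSumOfDecomposables m f.rep} s} :=
  Set.ext fun _ => hasRank_segre_iff

theorem mk_mem_interior_hasRank {v : TensorIndex n → ℝ} {hv : v ≠ 0} {s : ℕ} :
    Projectivization.mk ℝ v hv ∈ interior {f | HasRank (segre ℝ n) f s} ↔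
      ∀ᶠ w in 𝓝 v, IsLeast {m | IsSumOfDecomposables m w} s := by
  rw [setOf_hasRank]
  exact mk_mem_interior_iff (P := fun w => IsLeast {m | IsSumOfDecomposables m w} s) 
    (fun t v ht => isLeast_smul_iff v s ht) v hv

theorem mk_mem_closure_hasRank {v : TensorIndex n → ℝ} {hv : v ≠ 0} {s : ℕ} :
    Projectivization.mk ℝ v hv ∈ closure {f | HasRank (segre ℝ n) f s} ↔
      ∃ᶠ w in 𝓝 v, IsLeast {m | IsSumOfDecomposables m w} s := by
  rw [setOf_hasRank]
  exact mk_mem_closure_iff (P := fun w => IsLeast {m | IsSumOfDecomposables m w} s) 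
    (fun t v ht => isLeast_smul_iff v s ht) v hv

/-- Points near which the rank is constantly `s` exhibit `s` as a typical rank. -/
theorem isTypicalRank_of_eventually [NeZero n] {v : TensorIndex n → ℝ} {s : ℕ}
    (h : ∀ᶠ w in 𝓝 v, IsLeast {m | IsSumOfDecomposables m w} s) : IsTypicalRank (segre ℝ n) s := by
  obtain ⟨w, hw, hw0⟩ : ∃ w, (∀ᶠ u in 𝓝 w, IsLeast {m | IsSumOfDecomposables m u} s) ∧ w ≠ 0 := by
    -- The given `v` may be zero; a nearby vector with a nonzero coordinate defines a projective
    -- point.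
    have h1 := (IsPolyFun.coord (K := ℝ) (σ := TensorIndex n) (0, 0, 0)).dense ⟨1, one_ne_zero⟩
    obtain ⟨w, hw, hw'⟩ := (mem_closure_iff_frequently.1 (h1 v)).and_eventually h.eventually_nhds |>.exists
    exact ⟨w, hw', fun h0 => hw (by simp [h0])⟩
  exact ⟨Projectivization.mk ℝ w hw0, mk_mem_interior_hasRank.2 hw⟩

/-- Off the hypersurface `g = 0` only `n` and `n + 1` occur. A diagonal pencil with distinct real
eigenvalues realizes `n`; perturbing a pencil with a nonreal eigenvalue realizes `n + 1`. -/
theorem isTypicalRank_segre_iff (hn : 2 ≤ n) (s : ℕ) :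
    IsTypicalRank (segre ℝ n) s ↔ s = n ∨ s = n + 1 := by
  have : NeZero n := ⟨by omega⟩
  obtain ⟨g, hg, hg0, hgr⟩ := exists_isPolyFun_rank_le (K := ℝ) (n := n)
  have hrank : ∀ v, g v ≠ 0 → ∀ m, IsSumOfDecomposables m v → n ≤ m := fun v hv m hm =>
    not_lt.1 fun hlt => (hgr v hv).1 (by simpa using det_pencil_eq_zero hm hlt 1 0)
  constructor
  · rintro ⟨f, hf⟩
    rw [← f.mk_rep, mk_mem_interior_hasRank] at hf
    obtain ⟨w, hgw, hw⟩ := (mem_closure_iff_frequently.1 (hg.dense hg0 f.rep)).and_eventually hf |>.exists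
    have h1 := hw.2 (hgr w hgw).2
    have h2 := hrank w hgw s hw.1
    omega
  · rintro (rfl | rfl)
    · refine isTypicalRank_of_eventually (v := ofSlices (Matrix.diagonal fun i => (i : ℝ)) 1)
        (eventually_isLeast (α := 0) (by simp) (ρ := fun i => (i : ℝ))
          (fun i j hij => Fin.ext (Nat.cast_injective hij)) fun x => ?_)
      simp [Matrix.smul_one_eq_diagonal, Matrix.diagonal_sub, Matrix.det_diagonal]
    · let i0 : Fin n := ⟨0, by omega⟩
      let i1 : Fin n := ⟨1, by omega⟩
      have hi : i0 ≠ i1 := by simp [i0, i1]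
      -- A quarter turn in one coordinate plane has eigenvalue `Complex.I`, so the inequality for
      -- rank `n` fails at `v` and on a neighbourhood of it.
      let v : TensorIndex n → ℝ := ofSlices (Matrix.single i0 i1 1 - Matrix.single i1 i0 1) 1
      have hdet : (Complex.I • (1 : Matrix (Fin n) (Fin n) ℂ) -
          (Matrix.single i0 i1 1 - Matrix.single i1 i0 1)).det = 0 := by
        refine Matrix.exists_mulVec_eq_zero_iff.1
          ⟨Pi.single i0 1 + Pi.single i1 Complex.I, fun h0 => ?_, ?_⟩
        · simpa [hi] using congrFun h0 i0
        · ext j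
          simp only [Matrix.mulVec_add, Matrix.mulVec_single, Matrix.sub_apply, Matrix.smul_apply,
            Matrix.one_apply, Matrix.single_apply, Pi.add_apply, Pi.smul_apply, Matrix.col_apply,
            MulOpposite.smul_eq_mul_unop, MulOpposite.unop_op, smul_eq_mul, Pi.zero_apply]
          by_cases h0 : j = i0
          · simp [h0, hi, hi.symm]
          · by_cases h1 : j = i1
            · simp [h1, hi, hi.symm]
            · simp [h0, h1, Ne.symm h0, Ne.symm h1]
      have hv := (isClosed_abs_im_pow_mul_le (n := n) 0 Complex.I).isOpen_compl.mem_nhds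
        (x := v) (by
          have hmap : (Matrix.single i0 i1 (1 : ℝ) - Matrix.single i1 i0 1).map Complex.ofRealHom =
              Matrix.single i0 i1 1 - Matrix.single i1 i0 1 := by
            ext j k
            simp only [Matrix.map_apply, Matrix.sub_apply, Matrix.single_apply, map_sub]
            split_ifs <;> simp
          simp [v, hmap, hdet])
      obtain ⟨w, hgw, hw⟩ := (mem_closure_iff_frequently.1 (hg.dense hg0 v)).and_eventually
        (eventually_eventually_nhds.2 hv) |>.exists
      refine isTypicalRank_of_eventually (v := w) ?_
      filter_upwards [hw, hg.continuous.continuousAt.eventually_ne hgw] with u hu hgu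
      refine ⟨(hgr u hgu).2, fun m hm => ?_⟩
      rcases (hrank u hgu m hm).eq_or_lt with rfl | hlt
      · exact absurd (abs_im_pow_mul_le hm 0 Complex.I) hu
      · exact hlt

end RealPencils

/-! ### Degeneracy of pencils on the boundary. -/

section Boundary

variable {n : ℕ}

/-- A real tensor on the boundary of the rank `n` locus has a degenerate complex pencil: in
triangular form two pairs of diagonal entries are proportional. -/
theorem exists_degenerate_of_mem_boundary (hn : 2 ≤ n) {v : TensorIndex n → ℝ} {hv : v ≠ 0}
    (hcl : Projectivization.mk ℝ v hv ∈ closure {f | HasRank (segre ℝ n) f n})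
    (hint : Projectivization.mk ℝ v hv ∉ interior {f | HasRank (segre ℝ n) f n}) :
    ∃ Q Z S T : Matrix (Fin n) (Fin n) ℂ, S.IsUpperTriangular ∧ T.IsUpperTriangular ∧
      (slice v 0).map Complex.ofRealHom = Q * S * Z ∧
      (slice v 1).map Complex.ofRealHom = Q * T * Z ∧
      ∃ i j, i ≠ j ∧ S i i * T j j = S j j * T i i := by
  obtain ⟨Q, Z, S, T, hQ, hZ, hS, hT, h0, h1⟩ := exists_simultaneous_triangular
    ((slice v 0).map Complex.ofRealHom) ((slice v 1).map Complex.ofRealHom)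
  refine ⟨Q, Z, S, T, hS, hT, h0, h1, ?_⟩
  by_contra! hind
  -- Each `i` excludes at most one `α`: otherwise both its diagonal entries vanish and are
  -- proportional to any other pair, which exists as `n ≥ 2`.
  obtain ⟨α, hα⟩ : ∃ α : ℝ, ∀ i, (α : ℂ) * S i i + T i i ≠ 0 := by
    have hfin : (⋃ i, {α : ℝ | (α : ℂ) * S i i + T i i = 0}).Finite := by
      refine Set.finite_iUnion fun i => Set.Subsingleton.finite fun α hα β hβ => ?_
      by_contra hne
      have h2 : ((α : ℂ) - β) * S i i = 0 := by
        have hα' : (α : ℂ) * S i i + T i i = 0 := hα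
        have hβ' : (β : ℂ) * S i i + T i i = 0 := hβ
        linear_combination hα' - hβ'
      have h3 : S i i = 0 := (mul_eq_zero.1 h2).resolve_left fun h =>
        hne (Complex.ofReal_injective (sub_eq_zero.1 h))
      have h4 : T i i = 0 := by
        have : (α : ℂ) * S i i + T i i = 0 := hα
        simpa [h3] using this
      obtain ⟨j, hj⟩ : ∃ j, i ≠ j := by
        have : Nontrivial (Fin n) := Fin.nontrivial_iff_two_le.2 hn
        obtain ⟨j, hj⟩ := exists_ne i
        exact ⟨j, hj.symm⟩
      exact hind i j hj (by simp [h3, h4])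
    obtain ⟨α, hα⟩ := hfin.infinite_compl.nonempty
    exact ⟨α, fun i h => hα (Set.mem_iUnion.2 ⟨i, h⟩)⟩
  set A' := α • slice v 0 + slice v 1 with hA'
  have hA'c : A'.map Complex.ofRealHom = Q * ((α : ℂ) • S + T) * Z := by
    have h2 : A'.map Complex.ofRealHom =
        (α : ℂ) • (slice v 0).map Complex.ofRealHom + (slice v 1).map Complex.ofRealHom := by
      ext j k; simp [hA']
    rw [h2, h0, h1, Matrix.mul_add, Matrix.add_mul, Matrix.mul_smul, Matrix.smul_mul]
  have hdet : ∀ z : ℂ, (z • A'.map Complex.ofRealHom - (slice v 0).map Complex.ofRealHom).det =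
      Q.det * Z.det * ∏ i, (z * ((α : ℂ) * S i i + T i i) - S i i) := by
    intro z
    have h2 : z • A'.map Complex.ofRealHom - (slice v 0).map Complex.ofRealHom =
        Q * (z • ((α : ℂ) • S + T) - S) * Z := by
      rw [hA'c, h0, Matrix.mul_sub, Matrix.sub_mul, Matrix.mul_smul, Matrix.smul_mul]
    have h3 : (z • ((α : ℂ) • S + T) - S).IsUpperTriangular := fun i j hij => by
      simp [hS hij, hT hij]
    rw [h2, Matrix.det_mul, Matrix.det_mul, Matrix.det_of_isUpperTriangular h3]
    simp only [Matrix.sub_apply, Matrix.smul_apply, Matrix.add_apply, smul_eq_mul]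
    ring
  have hdetA : (A'.det : ℂ) = Q.det * Z.det * ∏ i, ((α : ℂ) * S i i + T i i) := by
    have h3 : ((α : ℂ) • S + T).IsUpperTriangular := fun i j hij => by
      simp [hS hij, hT hij]
    have h4 : (A'.det : ℂ) = (A'.map Complex.ofRealHom).det := RingHom.map_det Complex.ofRealHom A'
    rw [h4, hA'c, Matrix.det_mul, Matrix.det_mul, Matrix.det_of_isUpperTriangular h3]
    simp only [Matrix.smul_apply, Matrix.add_apply, smul_eq_mul]
    ring
  have hA'0 : A'.det ≠ 0 := fun h => by
    rw [h, Complex.ofReal_zero] at hdetA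
    exact mul_ne_zero (mul_ne_zero hQ hZ) (Finset.prod_ne_zero_iff.2 fun i _ => hα i) hdetA.symm
  let ρ : Fin n → ℂ := fun i => S i i / ((α : ℂ) * S i i + T i i)
  have hρ : ∀ i, S i i = ρ i * ((α : ℂ) * S i i + T i i) := fun i => by
    simp only [ρ]; rw [div_mul_cancel₀ _ (hα i)]
  have hρinj : Function.Injective ρ := fun i j hij => by
    by_contra hne
    refine hind i j hne ?_
    have h2 := (div_eq_div_iff (hα i) (hα j)).1 hij
    linear_combination h2
  have hdet' : ∀ z : ℂ, (z • A'.map Complex.ofRealHom - (slice v 0).map Complex.ofRealHom).det =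
      A'.det * ∏ i, (z - ρ i) := by
    intro z
    have h2 : ∏ i, (z * ((α : ℂ) * S i i + T i i) - S i i) =
        (∏ i, ((α : ℂ) * S i i + T i i)) * ∏ i, (z - ρ i) := by
      rw [← Finset.prod_mul_distrib]
      exact Finset.prod_congr rfl fun i _ => by linear_combination (-1 : ℂ) * hρ i
    rw [hdet, hdetA, h2]
    ring
  -- Distinct real eigenvalues would make the point interior; a nonreal one would violate, at `z = ρ
  -- i`, the closed inequality inherited from rank `n`.
  by_cases hreal : ∀ i, (ρ i).im = 0
  · refine hint (mk_mem_interior_hasRank.2 ?_)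
    have hre : ∀ i, (((ρ i).re : ℝ) : ℂ) = ρ i := fun i => Complex.ext (by simp) (by simp [hreal i])
    refine eventually_isLeast hA'0 (ρ := fun i => (ρ i).re) (fun i j hij => hρinj ?_) fun x => ?_
    · rw [← hre i, ← hre j]
      exact congrArg _ hij
    · apply Complex.ofReal_injective
      have h2 := hdet' x
      have h3 : (x : ℂ) • A'.map Complex.ofRealHom - (slice v 0).map Complex.ofRealHom =
          (x • A' - slice v 0).map Complex.ofRealHom := by
        ext j k; simp
      have h4 : ((x • A' - slice v 0).map Complex.ofRealHom).det = ((x • A' - slice v 0).det : ℂ) :=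
        (RingHom.map_det Complex.ofRealHom _).symm
      rw [h3, h4] at h2
      rw [h2]
      rw [← hA', Complex.ofReal_mul, Complex.ofReal_prod]
      simp only [Complex.ofReal_sub, hre]
  · push Not at hreal
    obtain ⟨i, hi⟩ := hreal
    rw [mk_mem_closure_hasRank] at hcl
    have h2 := (isClosed_abs_im_pow_mul_le (n := n) α (ρ i)).mem_of_frequently_of_tendsto
      (hcl.mono fun w hw => abs_im_pow_mul_le hw.1 α (ρ i)) tendsto_id
    have h3 : |(ρ i).im| ^ n * |A'.det| ≤ ‖(ρ i • A'.map Complex.ofRealHom -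
        (slice v 0).map Complex.ofRealHom).det‖ := h2
    rw [hdet', Finset.prod_eq_zero (Finset.mem_univ i) (sub_self _), mul_zero, norm_zero] at h3
    have h4 : 0 < |(ρ i).im| ^ n * |A'.det| := by positivity
    linarith

end Boundary

/-! ### Cones over the tangential and secant varieties. -/

section Cones

variable {K : Type*} [Field K] {n : ℕ}

/-- The points whose Zariski closure is the tangential variety. -/
def tangentPoints (n : ℕ) : Set (ℙ ℂ (TensorIndex n → ℂ)) :=
  {y | ∃ x ∈ segre ℂ n, y ∈ tangentSpace (segre ℂ n) x}

variable (K n) in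
/-- The points whose Zariski closure is the `k`-th secant variety. -/
def secantPoints (k : ℕ) : Set (ℙ K (TensorIndex n → K)) :=
  {f | ∃ x : Fin k → ℙ K (TensorIndex n → K), (∀ i, x i ∈ segre K n) ∧ f ∈ linSpan (Set.range x)}

/-- If one of `a`, `b`, `c` is zero there is no base point, but then the vector is decomposable and
tangent at itself. -/
theorem tangentVec_mem_affineCone (a a' : Fin 2 → ℂ) (b b' c c' : Fin n → ℂ) :
    tangentVec a a' b b' c c' ∈ affineCone (tangentPoints n) := by
  have key : ∀ (a a' : Fin 2 → ℂ) (b b' c c' : Fin n → ℂ), decomposable a b c ≠ 0 →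
      tangentVec a a' b b' c c' ∈ affineCone (tangentPoints n) := by
    intro a a' b b' c c' h h0
    obtain ⟨t, ht⟩ := Projectivization.exists_smul_eq_mk_rep ℂ _ h
    obtain ⟨s, hs⟩ := Projectivization.exists_smul_eq_mk_rep ℂ _ h0
    refine ⟨Projectivization.mk ℂ _ h, mk_mem_segre_iff.2 ⟨_, _, _, rfl⟩,
      tangentVec_mem_tangentSpace (a := (t : ℂ) • a) (b := b) (c := c) (a' := (s : ℂ) • a')
        (b' := ((s : ℂ) / t) • b') (c' := ((s : ℂ) / t) • c') ?_ ?_⟩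
    · rw [← ht, Units.smul_def, smul_decomposable]
    · rw [← hs, Units.smul_def]
      ext i
      have := t.ne_zero
      simp [tangentVec, decomposable]
      field_simp
  have dec : ∀ (a : Fin 2 → ℂ) (b c : Fin n → ℂ),
      decomposable a b c ∈ affineCone (tangentPoints n) := by
    intro a b c
    by_cases h : decomposable a b c = 0
    · rw [h]; exact zero_mem_affineCone _
    · simpa [tangentVec] using key a a b 0 c 0 h
  by_cases ha : a = 0
  · simpa [tangentVec, ha] using dec a' b c
  by_cases hb : b = 0
  · simpa [tangentVec, hb] using dec a b' c
  by_cases hc : c = 0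
  · simpa [tangentVec, hc] using dec a b c'
  refine key a a' b b' c c' fun h => ?_
  obtain ⟨i, hi⟩ := Function.ne_iff.1 ha
  obtain ⟨j, hj⟩ := Function.ne_iff.1 hb
  obtain ⟨k, hk⟩ := Function.ne_iff.1 hc
  exact mul_ne_zero (mul_ne_zero hi hj) hk (congrFun h (i, j, k))

theorem exists_eq_tangentVec_of_mem_affineCone {v : TensorIndex n → ℂ}
    (hv : v ∈ affineCone (tangentPoints n)) :
    ∃ a a' b b' c c', v = tangentVec a a' b b' c c' := by
  by_cases h0 : v = 0
  · exact ⟨0, 0, 0, 0, 0, 0, by simp [tangentVec, h0]⟩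
  obtain ⟨x, hx, hy⟩ := hv h0
  obtain ⟨a, a', b, b', c, c', h⟩ := exists_eq_tangentVec hx hy
  obtain ⟨t, ht⟩ := Projectivization.exists_smul_eq_mk_rep ℂ v h0
  refine ⟨a, (t : ℂ)⁻¹ • a', b, (t : ℂ)⁻¹ • b', c, (t : ℂ)⁻¹ • c', ?_⟩
  have h1 : v = (t : ℂ)⁻¹ • tangentVec a a' b b' c c' := by
    rw [← h, ← ht, Units.smul_def, inv_smul_smul₀ t.ne_zero]
  rw [h1]
  ext i
  simp [tangentVec, decomposable]
  ring

theorem mem_affineCone_secantPoints_iff {k : ℕ} {v : TensorIndex n → K} :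
    v ∈ affineCone (secantPoints K n k) ↔ IsSumOfDecomposables k v := by
  classical
  constructor
  · intro hv
    by_cases h0 : v = 0
    · exact ⟨0, 0, 0, by simp [h0]⟩
    obtain ⟨x, hx, hf⟩ := hv h0
    obtain ⟨t, ht⟩ := Projectivization.exists_smul_eq_mk_rep K v h0
    have h1 : IsSumOfDecomposables (Finset.univ.image x).card (Projectivization.mk K v h0).rep := by
      refine isSumOfDecomposables_of_mem_linSpan ?_ ?_
      · rw [Finset.coe_image, Finset.coe_univ, Set.image_univ]
        exact Set.range_subset_iff.2 hx
      · rwa [Finset.coe_image, Finset.coe_univ, Set.image_univ]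
    rw [← ht, Units.smul_def, IsSumOfDecomposables.smul_iff t.ne_zero] at h1
    exact h1.mono (by simpa using Finset.card_image_le (s := Finset.univ) (f := x))
  · rintro ⟨a, b, c, rfl⟩ h0
    obtain ⟨i₀, -, hi₀⟩ := Finset.exists_ne_zero_of_sum_ne_zero h0
    -- Zero summands define no point; a fixed nonzero summand takes their place, repetitions being
    -- allowed.
    let x : Fin k → ℙ K (TensorIndex n → K) := fun i =>
      if h : decomposable (a i) (b i) (c i) = 0 then Projectivization.mk K _ hi₀
      else Projectivization.mk K _ h
    refine ⟨x, fun i => ?_, ?_⟩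
    · simp only [x]
      split_ifs
      · exact mk_mem_segre_iff.2 ⟨_, _, _, rfl⟩
      · exact mk_mem_segre_iff.2 ⟨_, _, _, rfl⟩
    · change (Projectivization.mk K _ h0).submodule ≤ _
      rw [Projectivization.submodule_mk, Submodule.span_singleton_le_iff_mem]
      refine Submodule.sum_mem _ fun i _ => ?_
      by_cases hi : decomposable (a i) (b i) (c i) = 0
      · rw [hi]; exact Submodule.zero_mem _
      · refine Submodule.mem_iSup_of_mem (x i) (Submodule.mem_iSup_of_mem ⟨i, rfl⟩ ?_)
        simp only [x, dif_neg hi, Projectivization.submodule_mk]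
        exact Submodule.mem_span_singleton_self _

theorem affineCone_mono {ι : Type*} {S T : Set (ℙ K (ι → K))} (h : S ⊆ T) :
    affineCone S ⊆ affineCone T :=
  fun _ hv h0 => h (hv h0)

/-- The sum of a tangent vector and `k` decomposable tensors lies in the join. -/
theorem tangentVec_add_mem_join {k : ℕ} (a a' : Fin 2 → ℂ) (b b' c c' : Fin n → ℂ)
    {w : TensorIndex n → ℂ} (hw : IsSumOfDecomposables k w) :
    tangentVec a a' b b' c c' + w ∈
      affineCone (join (tangentialVariety (segre ℂ n)) (secantVariety k (segre ℂ n))) :=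
  fun h => subset_zariskiClosure _ ⟨_,
    affineCone_mono (subset_zariskiClosure _) (tangentVec_mem_affineCone a a' b b' c c'), w,
    affineCone_mono (subset_zariskiClosure _) (mem_affineCone_secantPoints_iff.2 hw), h, rfl⟩

end Cones

/-! ### Degenerate pencils lie in the join. -/

section Degenerate

variable {K : Type*} [Field K] {n : ℕ}

/-- Multiplying by `det S` turns the characteristic polynomial into `det (X S - T)`, the determinant
of a triangular matrix. -/
theorem charpoly_inv_mul_of_isUpperTriangular {S T : Matrix (Fin n) (Fin n) K}
    (hS : S.IsUpperTriangular) (hT : T.IsUpperTriangular) (hs : ∀ k, S k k ≠ 0) :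
    (S⁻¹ * T).charpoly = ∏ k, (Polynomial.X - Polynomial.C (T k k / S k k)) := by
  have hdet : S.det ≠ 0 := by
    rw [Matrix.det_of_isUpperTriangular hS]
    exact Finset.prod_ne_zero_iff.2 fun k _ => hs k
  have h1 : (Polynomial.C : K →+* Polynomial K).mapMatrix S * (S⁻¹ * T).charmatrix =
      (Polynomial.X : Polynomial K) • (Polynomial.C : K →+* Polynomial K).mapMatrix S -
        (Polynomial.C : K →+* Polynomial K).mapMatrix T := by
    rw [Matrix.charmatrix, mul_sub, ← map_mul, ← mul_assoc, Matrix.mul_nonsing_inv _ hdet.isUnit,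
      one_mul, Matrix.scalar_apply, ← Matrix.smul_one_eq_diagonal, Matrix.mul_smul, Matrix.mul_one]
  have h2 : ((Polynomial.X : Polynomial K) • (Polynomial.C : K →+* Polynomial K).mapMatrix S -
        (Polynomial.C : K →+* Polynomial K).mapMatrix T :
      Matrix (Fin n) (Fin n) (Polynomial K)).IsUpperTriangular := fun i j hij => by
    simp [hS hij, hT hij]
  have h3 := congrArg Matrix.det h1
  rw [Matrix.det_mul, Matrix.det_of_isUpperTriangular h2, ← RingHom.map_det,
    Matrix.det_of_isUpperTriangular hS, map_prod] at h3
  refine mul_left_cancel₀ (a := ∏ k, Polynomial.C (S k k)) ?_ (h3.trans ?_)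
  · exact Finset.prod_ne_zero_iff.2 fun k _ => Polynomial.C_ne_zero.2 (hs k)
  · rw [← Finset.prod_mul_distrib]
    refine Finset.prod_congr rfl fun k _ => ?_
    have h4 : Polynomial.C (S k k) * Polynomial.C (T k k / S k k) = Polynomial.C (T k k) := by
      rw [← map_mul, mul_div_cancel₀ _ (hs k)]
    simp only [Matrix.sub_apply, Matrix.smul_apply, RingHom.mapMatrix_apply, Matrix.map_apply,
      smul_eq_mul]
    linear_combination h4

/-- A pencil with one double and otherwise simple eigenvalues is the sum of a tangent vector and
`n - 2` decomposable tensors. -/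
theorem exists_eq_tangentVec_add {Q Z S T : Matrix (Fin n) (Fin n) K}
    (hS : S.IsUpperTriangular) (hT : T.IsUpperTriangular) (hs : ∀ k, S k k ≠ 0)
    {i₀ j₀ : Fin n} (hij : i₀ ≠ j₀) (hμ : T i₀ i₀ / S i₀ i₀ = T j₀ j₀ / S j₀ j₀)
    (hinj : ∀ k l, k ≠ j₀ → l ≠ j₀ → T k k / S k k = T l l / S l l → k = l) :
    ∃ a a' b b' c c' w, IsSumOfDecomposables (n - 2) w ∧
      ofSlices (Q * S * Z) (Q * T * Z) = tangentVec a a' b b' c c' + w := by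
  classical
  have hdet : S.det ≠ 0 := by
    rw [Matrix.det_of_isUpperTriangular hS]
    exact Finset.prod_ne_zero_iff.2 fun k _ => hs k
  obtain ⟨P, c, hP, hMP⟩ := exists_mul_eq_mul_diagonal_add_single
    (charpoly_inv_mul_of_isUpperTriangular hS hT hs) hij hμ hinj
  let μ : Fin n → K := fun k => T k k / S k k
  let U := Q * S * P
  let W := P⁻¹ * Z
  have hA : Q * S * Z = U * Matrix.diagonal 1 * W := by
    rw [Pi.one_def, Matrix.diagonal_one, Matrix.mul_one]
    simp only [U, W]
    rw [Matrix.mul_assoc (Q * S) P, ← Matrix.mul_assoc P, Matrix.mul_nonsing_inv _ hP.isUnit,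
      Matrix.one_mul]
  have hB : Q * T * Z = U * Matrix.diagonal μ * W + U * Matrix.single i₀ j₀ c * W := by
    have h1 : T = S * P * (Matrix.diagonal μ + Matrix.single i₀ j₀ c) * P⁻¹ := by
      rw [Matrix.mul_assoc S P, ← hMP, ← Matrix.mul_assoc, Matrix.mul_assoc _ P,
        Matrix.mul_nonsing_inv _ hP.isUnit, Matrix.mul_one, ← Matrix.mul_assoc,
        Matrix.mul_nonsing_inv _ hdet.isUnit, Matrix.one_mul]
    conv_lhs => rw [h1]
    simp only [U, W, Matrix.mul_assoc, Matrix.mul_add, Matrix.add_mul]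
  let s : Finset (Fin n) := (Finset.univ.erase i₀).erase j₀
  have hcard : s.card = n - 2 := by
    rw [Finset.card_erase_of_mem (Finset.mem_erase.2 ⟨hij.symm, Finset.mem_univ _⟩),
      Finset.card_erase_of_mem (Finset.mem_univ _), Finset.card_univ, Fintype.card_fin]
    rfl
  -- The Jordan block is tangent at `(1, μ) ⊗ U_{i₀} ⊗ W_{j₀}`: varying the two matrix factors gives
  -- its diagonal part, varying the first factor gives the entry `c`. The indices of `U` and `W` are
  -- therefore crossed.
  refine ⟨![1, μ i₀], ![0, c], fun j => U j i₀, fun j => U j j₀, W j₀, W i₀,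
    ∑ k ∈ s, decomposable ![1, μ k] (fun j => U j k) (W k), ?_, ?_⟩
  · rw [← hcard]
    exact isSumOfDecomposables_finset_sum _ _ _ _
  · have hsum : ∀ F : Fin n → K, ∑ k, F k = F i₀ + (F j₀ + ∑ k ∈ s, F k) := fun F => by
      rw [Finset.add_sum_erase _ _ (Finset.mem_erase.2 ⟨hij.symm, Finset.mem_univ _⟩),
        Finset.add_sum_erase _ _ (Finset.mem_univ _)]
    have hμ' : μ j₀ = μ i₀ := hμ.symm
    ext ⟨l, j, k⟩
    fin_cases l
    · change (Q * S * Z) j k = _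
      rw [hA, mul_diagonal_mul_apply, hsum]
      simp [tangentVec, decomposable, Finset.sum_apply]
      ring
    · change (Q * T * Z) j k = _
      have h2 : (U * Matrix.single i₀ j₀ c * W) j k = c * U j i₀ * W j₀ k := by
        rw [Matrix.mul_apply, Finset.sum_eq_single j₀]
        · rw [Matrix.mul_single_apply_same]; ring
        · intro b _ hb
          rw [Matrix.mul_single_apply_of_ne _ _ _ _ _ hb, zero_mul]
        · simp
      rw [hB, Matrix.add_apply, h2, mul_diagonal_mul_apply, hsum, hμ']
      simp [tangentVec, decomposable, Finset.sum_apply]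
      ring

/-- The family of pairs of upper triangular matrices whose `j₀`-th diagonal entries are a common
multiple of the `i₀`-th ones. -/
def triangularFamily (i₀ j₀ : Fin n) (x : Option (TensorIndex n) → K) (l : Fin 2) :
    Matrix (Fin n) (Fin n) K :=
  Matrix.of fun i j => if i < j then x (some (l, i, j)) else if i = j then
    (if i = j₀ then x none * x (some (l, i₀, i₀)) else x (some (l, i, i))) else 0

theorem triangularFamily_diag (i₀ j₀ : Fin n) (x : Option (TensorIndex n) → K) (l : Fin 2)
    (i : Fin n) : triangularFamily i₀ j₀ x l i i =
      if i = j₀ then x none * x (some (l, i₀, i₀)) else x (some (l, i, i)) := by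
  simp [triangularFamily]

theorem triangularFamily_isUpperTriangular (i₀ j₀ : Fin n) (x : Option (TensorIndex n) → K)
    (l : Fin 2) : (triangularFamily i₀ j₀ x l).IsUpperTriangular := fun i j hij => by
  have h : j < i := hij
  simp [triangularFamily, h.not_gt, h.ne']

theorem isPolyFun_triangularFamily (i₀ j₀ : Fin n) (l : Fin 2) (i j : Fin n) :
    IsPolyFun (fun x : Option (TensorIndex n) → K => triangularFamily i₀ j₀ x l i j) :=
  .ite (.coord _) (.ite (.ite (.mul (.coord _) (.coord _)) (.coord _)) (.const _))

theorem isPolyFun_mul_mul {σ : Type*} (Q Z : Matrix (Fin n) (Fin n) K)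
    {M : (σ → K) → Matrix (Fin n) (Fin n) K} (h : ∀ i j, IsPolyFun (fun x => M x i j))
    (i j : Fin n) : IsPolyFun (fun x => (Q * M x * Z) i j) := by
  simp only [Matrix.mul_apply]
  exact .sum fun k _ => .mul (.sum fun l _ => .mul (.const _) (h _ _)) (.const _)

/-- Degenerate pencils lie in the join of the tangential variety and the secant variety. -/
theorem ofSlices_mem_join {Q Z S T : Matrix (Fin n) (Fin n) ℂ} (hS : S.IsUpperTriangular)
    (hT : T.IsUpperTriangular) {i₀ j₀ : Fin n} (hij : i₀ ≠ j₀) {κ : ℂ}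
    (h0 : S j₀ j₀ = κ * S i₀ i₀) (h1 : T j₀ j₀ = κ * T i₀ i₀) :
    ofSlices (Q * S * Z) (Q * T * Z) ∈
      affineCone (join (tangentialVariety (segre ℂ n)) (secantVariety (n - 2) (segre ℂ n))) := by
  classical
  intro hne
  refine mk_mem_zariskiClosure.2 fun F d hF hvan => ?_
  let ψ : (Option (TensorIndex n) → ℂ) → TensorIndex n → ℂ := fun x =>
    ofSlices (Q * triangularFamily i₀ j₀ x 0 * Z) (Q * triangularFamily i₀ j₀ x 1 * Z)
  have hψ : ∀ i, IsPolyFun (fun x => ψ x i) := by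
    rintro ⟨l, j, k⟩
    fin_cases l
    · exact isPolyFun_mul_mul Q Z (isPolyFun_triangularFamily i₀ j₀ 0) j k
    · exact isPolyFun_mul_mul Q Z (isPolyFun_triangularFamily i₀ j₀ 1) j k
  -- Where `g ≠ 0` the first slice of the triangular pair is invertible and the eigenvalues other
  -- than the `j₀`-th are distinct, so the decomposition with one double eigenvalue applies.
  let g : (Option (TensorIndex n) → ℂ) → ℂ := fun x =>
    (∏ k, triangularFamily i₀ j₀ x 0 k k) *
      ∏ k ∈ Finset.univ.erase j₀, ∏ l ∈ (Finset.univ.erase j₀).erase k,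
        (triangularFamily i₀ j₀ x 1 k k * triangularFamily i₀ j₀ x 0 l l -
          triangularFamily i₀ j₀ x 1 l l * triangularFamily i₀ j₀ x 0 k k)
  have hg : IsPolyFun g :=
    .mul (.prod fun k _ => isPolyFun_triangularFamily _ _ _ _ _) (.prod fun k _ => .prod fun l _ =>
      .sub (.mul (isPolyFun_triangularFamily _ _ _ _ _) (isPolyFun_triangularFamily _ _ _ _ _))
        (.mul (isPolyFun_triangularFamily _ _ _ _ _) (isPolyFun_triangularFamily _ _ _ _ _)))
  have hgen : ∀ x, g x ≠ 0 → ∀ i, ψ x i * MvPolynomial.eval (ψ x) F = 0 := by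
    intro x hx i
    by_cases hx0 : ψ x = 0
    · simp [hx0]
    obtain ⟨hx1, hx2⟩ := mul_ne_zero_iff.1 hx
    have hs : ∀ k, triangularFamily i₀ j₀ x 0 k k ≠ 0 := fun k =>
      Finset.prod_ne_zero_iff.1 hx1 k (Finset.mem_univ k)
    have hμ : triangularFamily i₀ j₀ x 1 i₀ i₀ / triangularFamily i₀ j₀ x 0 i₀ i₀ =
        triangularFamily i₀ j₀ x 1 j₀ j₀ / triangularFamily i₀ j₀ x 0 j₀ j₀ := by
      rw [div_eq_div_iff (hs _) (hs _)]
      simp only [triangularFamily_diag, hij, if_true, if_false]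
      ring
    obtain ⟨a, a', b, b', c, c', w, hw, e⟩ := exists_eq_tangentVec_add (Q := Q) (Z := Z)
      (triangularFamily_isUpperTriangular i₀ j₀ x 0) (triangularFamily_isUpperTriangular i₀ j₀ x 1)
      hs hij hμ fun k l hk hl hkl => by
        by_contra hkl'
        have h2 := Finset.prod_ne_zero_iff.1 (Finset.prod_ne_zero_iff.1 hx2 k
          (Finset.mem_erase.2 ⟨hk, Finset.mem_univ _⟩)) l
          (Finset.mem_erase.2 ⟨Ne.symm hkl', Finset.mem_erase.2 ⟨hl, Finset.mem_univ _⟩⟩)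
        exact h2 (sub_eq_zero.2 ((div_eq_div_iff (hs k) (hs l)).1 hkl))
    have h3 : ψ x ∈ affineCone (join (tangentialVariety (segre ℂ n))
        (secantVariety (n - 2) (segre ℂ n))) := by
      change ofSlices _ _ ∈ _
      rw [e]
      exact tangentVec_add_mem_join a a' b b' c c' hw
    rw [mk_mem_zariskiClosure.1 (h3 hx0) F d hF hvan, mul_zero]
  have hg0 : ∃ x, g x ≠ 0 := by
    -- At this point the multiplier is `1` and, for `k ≠ j₀`, the `k`-th eigenvalue is `k`.
    refine ⟨fun o => o.elim 1 fun i => if i.1 = 0 then 1 else (i.2.1 : ℂ), ?_⟩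
    simp only [g, triangularFamily_diag]
    refine mul_ne_zero (Finset.prod_ne_zero_iff.2 fun k _ => by simp)
      (Finset.prod_ne_zero_iff.2 fun k hk => Finset.prod_ne_zero_iff.2 fun l hl => ?_)
    have hk' := Finset.ne_of_mem_erase hk
    have hl' := Finset.ne_of_mem_erase (Finset.mem_of_mem_erase hl)
    have hlk := Finset.ne_of_mem_erase hl
    simp only [hk', hl', if_false, Option.elim_some, if_true, one_ne_zero, mul_one]
    rw [sub_ne_zero]
    exact fun h => hlk (Fin.ext (Nat.cast_injective h.symm))
  let x₀ : Option (TensorIndex n) → ℂ := fun o => o.elim κ (ofSlices S T)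
  have hfam : ∀ (M : Matrix (Fin n) (Fin n) ℂ) (l : Fin 2), M.IsUpperTriangular →
      M j₀ j₀ = κ * M i₀ i₀ → (∀ i j, ofSlices S T (l, i, j) = M i j) →
      triangularFamily i₀ j₀ x₀ l = M := by
    intro M l hM hκ hl
    ext i j
    simp only [triangularFamily, Matrix.of_apply, x₀, Option.elim_some, Option.elim_none, hl]
    split_ifs with h2 h3 h4
    · rfl
    · rw [← h3, h4, hκ]
    · rw [h3]
    · exact (hM (lt_of_le_of_ne (not_lt.1 h2) (Ne.symm h3))).symm
  have hψ0 : ψ x₀ = ofSlices (Q * S * Z) (Q * T * Z) := by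
    simp only [ψ]
    rw [hfam S 0 hS h0 fun _ _ => rfl, hfam T 1 hT h1 fun _ _ => rfl]
  obtain ⟨i, hi⟩ := Function.ne_iff.1 hne
  have h2 := ((hψ i).mul (.comp F hψ)).eq_zero_of_generic hg (fun x hx => hgen x hx i) hg0 x₀
  rw [hψ0] at h2
  exact (mul_eq_zero.1 h2).resolve_left hi

end Degenerate

/-! ### Generic real points of the join lie on the boundary. -/

section JoinMap

variable {K : Type*} [Field K] {m : ℕ}

/-- The sum of a tangent vector and `m` decomposable tensors, as a function of all the vectors
involved. -/
def joinMap (a : Fin (m + 2) → Fin 2 → K) (b c : Fin (m + 2) → Fin (m + 2) → K) :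
    TensorIndex (m + 2) → K :=
  tangentVec (a 0) (a 1) (b 0) (b 1) (c 0) (c 1) +
    ∑ k : Fin m, decomposable (a k.succ.succ) (b k.succ.succ) (c k.succ.succ)

theorem joinMap_apply (a : Fin (m + 2) → Fin 2 → K) (b c : Fin (m + 2) → Fin (m + 2) → K) (l : Fin 2)
    (i j : Fin (m + 2)) : joinMap a b c (l, i, j) =
      a 1 l * b 0 i * c 0 j + a 0 l * b 1 i * c 0 j + a 0 l * b 0 i * c 1 j +
        ∑ k : Fin m, a k.succ.succ l * b k.succ.succ i * c k.succ.succ j := by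
  simp [joinMap, tangentVec, decomposable, Finset.sum_apply]

theorem slice_joinMap_mulVec (a : Fin (m + 2) → Fin 2 → K) (b c : Fin (m + 2) → Fin (m + 2) → K)
    (l : Fin 2) (y : Fin (m + 2) → K) : (slice (joinMap a b c) l).mulVec y =
      (a 1 l * (c 0 ⬝ᵥ y)) • b 0 + (a 0 l * (c 0 ⬝ᵥ y)) • b 1 + (a 0 l * (c 1 ⬝ᵥ y)) • b 0 +
        ∑ k : Fin m, (a k.succ.succ l * (c k.succ.succ ⬝ᵥ y)) • b k.succ.succ := by
  ext i
  simp only [Matrix.mulVec, dotProduct, slice_apply, joinMap_apply, Pi.add_apply, Pi.smul_apply,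
    Finset.sum_apply, smul_eq_mul, add_mul, Finset.sum_add_distrib, Finset.mul_sum, Finset.sum_mul]
  congr 1
  · congr 1
    · congr 1 <;> exact Finset.sum_congr rfl fun _ _ => by ring
    · exact Finset.sum_congr rfl fun _ _ => by ring
  · rw [Finset.sum_comm]
    exact Finset.sum_congr rfl fun _ _ => Finset.sum_congr rfl fun _ _ => by ring

/-- The pencil of a tensor of rank `n` with an invertible slice has no nontrivial Jordan chain. -/
theorem eq_zero_of_isSumOfDecomposables {n : ℕ} {v : TensorIndex n → K}
    (h : IsSumOfDecomposables n v) (hA : (slice v 0).det ≠ 0) {s t e d : K} (hd : d ≠ 0)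
    {x y : Fin n → K} (hy : (t • slice v 0 + s • slice v 1).mulVec y = 0)
    (hx : e • (t • slice v 0 + s • slice v 1).mulVec x = d • (slice v 0).mulVec y) : y = 0 := by
  obtain ⟨p, q, U, W, h0, h1⟩ := isSumOfDecomposables_iff_slice.1 h
  have hB : t • slice v 0 + s • slice v 1 = U * Matrix.diagonal (t • p + s • q) * W := by
    rw [h0, h1, smul_add_smul_mul_diagonal_mul]
  have hdet := hA
  rw [h0, Matrix.det_mul, Matrix.det_mul, Matrix.det_diagonal] at hdet
  have hU : U.det ≠ 0 := left_ne_zero_of_mul (left_ne_zero_of_mul hdet)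
  have hW : W.det ≠ 0 := right_ne_zero_of_mul hdet
  have hp : ∀ i, p i ≠ 0 := fun i => Finset.prod_ne_zero_iff.1
    (right_ne_zero_of_mul (left_ne_zero_of_mul hdet)) i (Finset.mem_univ i)
  rw [hB, ← Matrix.mulVec_mulVec, ← Matrix.mulVec_mulVec] at hy
  have hy1 := Matrix.eq_zero_of_mulVec_eq_zero hU hy
  have hx1 : e • (Matrix.diagonal (t • p + s • q)).mulVec (W.mulVec x) -
      d • (Matrix.diagonal p).mulVec (W.mulVec y) = 0 := by
    refine Matrix.eq_zero_of_mulVec_eq_zero hU ?_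
    rw [Matrix.mulVec_sub, Matrix.mulVec_smul, Matrix.mulVec_smul, sub_eq_zero]
    rw [hB, h0] at hx
    simpa only [← Matrix.mulVec_mulVec] using hx
  refine Matrix.eq_zero_of_mulVec_eq_zero hW (funext fun i => ?_)
  have hy2 := congrFun hy1 i
  have hx2 := congrFun hx1 i
  rw [Matrix.mulVec_diagonal] at hy2
  simp only [Pi.sub_apply, Pi.smul_apply, Matrix.mulVec_diagonal, smul_eq_mul, Pi.zero_apply,
    Pi.add_apply] at hx2 hy2 ⊢
  -- In the coordinates of `W` the pencil is diagonal: where its entry is zero the chain equation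
  -- kills the coordinate of `W y`, elsewhere the kernel equation does.
  by_cases hr : t * p i + s * q i = 0
  · rw [hr, zero_mul, mul_zero, zero_sub, neg_eq_zero] at hx2
    exact (mul_eq_zero.1 ((mul_eq_zero.1 hx2).resolve_left hd)).resolve_left (hp i)
  · exact (mul_eq_zero.1 hy2).resolve_left hr

/-- The vectors `x`, `y` dual to `c 0`, `c 1` form a Jordan chain: the combination of slices that
kills `y` maps `x` to a nonzero multiple of `b 0`, and the first slice maps `y` to `a 0 0 • b 0`.
Taking `e = a 0 0` avoids dividing by `a 0 0`. -/
theorem not_isSumOfDecomposables_joinMap {a : Fin (m + 2) → Fin 2 → K}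
    {b c : Fin (m + 2) → Fin (m + 2) → K} (hA : (slice (joinMap a b c) 0).det ≠ 0)
    (hc : (Matrix.of c).det ≠ 0) (ha : a 0 0 * a 1 1 - a 0 1 * a 1 0 ≠ 0) :
    ¬ IsSumOfDecomposables (m + 2) (joinMap a b c) := by
  intro h
  have hdual : ∀ i, ∃ y : Fin (m + 2) → K, ∀ k, c k ⬝ᵥ y = (Pi.single i 1 : Fin (m + 2) → K) k := by
    intro i
    refine ⟨(Matrix.of c)⁻¹.mulVec (Pi.single i 1), fun k => ?_⟩
    have h1 : (Matrix.of c).mulVec ((Matrix.of c)⁻¹.mulVec (Pi.single i 1)) = Pi.single i 1 := by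
      rw [Matrix.mulVec_mulVec, Matrix.mul_nonsing_inv _ hc.isUnit, Matrix.one_mulVec]
    exact congrFun h1 k
  obtain ⟨x, hx⟩ := hdual 0
  obtain ⟨y, hy⟩ := hdual 1
  have hss : ∀ k : Fin m, k.succ.succ ≠ 1 := fun k => by
    rw [← Fin.succ_zero_eq_one]
    exact fun h => Fin.succ_ne_zero k (Fin.succ_injective _ h)
  have hly : ∀ l, (slice (joinMap a b c) l).mulVec y = a 0 l • b 0 := fun l => by
    rw [slice_joinMap_mulVec]
    simp [hy, hss]
  have hlx : ∀ l, (slice (joinMap a b c) l).mulVec x = a 1 l • b 0 + a 0 l • b 1 := fun l => by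
    rw [slice_joinMap_mulVec]
    simp [hx]
  have hy0 : y = 0 := by
    refine eq_zero_of_isSumOfDecomposables h hA (t := -a 0 1) (s := a 0 0) (e := a 0 0)
      (x := x) ha ?_ ?_
    · rw [Matrix.add_mulVec, Matrix.smul_mulVec, Matrix.smul_mulVec, hly, hly]
      module
    · rw [Matrix.add_mulVec, Matrix.smul_mulVec, Matrix.smul_mulVec, hlx, hlx, hly]
      module
  have h1 := hy 1
  rw [hy0] at h1
  simp at h1

/-- A tangent vector is a limit of secant vectors. -/
theorem isSumOfDecomposables_joinMap_add {a : Fin (m + 2) → Fin 2 → K}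
    {b c : Fin (m + 2) → Fin (m + 2) → K} {ε : K} (hε : ε ≠ 0) :
    IsSumOfDecomposables (m + 2) (joinMap a b c + (ε • (decomposable (a 1) (b 1) (c 0) +
      decomposable (a 1) (b 0) (c 1) + decomposable (a 0) (b 1) (c 1)) +
        ε ^ 2 • decomposable (a 1) (b 1) (c 1))) := by
  -- The tangent vector plus the terms in `ε` and `ε ^ 2` is exactly the difference quotient of the
  -- curve of decomposables, hence a sum of two decomposables.
  have h1 : joinMap a b c + (ε • (decomposable (a 1) (b 1) (c 0) +
      decomposable (a 1) (b 0) (c 1) + decomposable (a 0) (b 1) (c 1)) +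
        ε ^ 2 • decomposable (a 1) (b 1) (c 1)) =
      ∑ k : Fin m, decomposable (a k.succ.succ) (b k.succ.succ) (c k.succ.succ) +
        (decomposable (ε⁻¹ • (a 0 + ε • a 1)) (b 0 + ε • b 1) (c 0 + ε • c 1) +
          decomposable (-ε⁻¹ • a 0) (b 0) (c 0)) := by
    rw [joinMap, add_comm (tangentVec _ _ _ _ _ _), add_assoc]
    congr 1
    ext i
    simp only [tangentVec, decomposable, Pi.add_apply, Pi.smul_apply, smul_eq_mul]
    field_simp
    ring
  rw [h1]
  exact IsSumOfDecomposables.add ⟨_, _, _, rfl⟩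
    ((isSumOfDecomposables_one _ _ _).add (isSumOfDecomposables_one _ _ _))

/-- The difference quotients have rank exactly `m + 2` for small `ε ≠ 0` and tend to the point,
whose own Jordan chain keeps it out of the rank locus. -/
theorem joinMap_mem_boundary {a : Fin (m + 2) → Fin 2 → ℝ} {b c : Fin (m + 2) → Fin (m + 2) → ℝ}
    (hA : (slice (joinMap a b c) 0).det ≠ 0) (hc : (Matrix.of c).det ≠ 0)
    (ha : a 0 0 * a 1 1 - a 0 1 * a 1 0 ≠ 0) :
    ∃ hv : joinMap a b c ≠ 0, Projectivization.mk ℝ (joinMap a b c) hv ∈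
      closure {f | HasRank (segre ℝ (m + 2)) f (m + 2)} \
        interior {f | HasRank (segre ℝ (m + 2)) f (m + 2)} := by
  have hv : joinMap a b c ≠ 0 := fun h0 => hA (by
    rw [h0, show slice (0 : TensorIndex (m + 2) → ℝ) 0 = 0 from rfl, Matrix.det_zero])
  refine ⟨hv, mk_mem_closure_hasRank.2 ?_, fun hint => ?_⟩
  · let γ : ℝ → TensorIndex (m + 2) → ℝ := fun ε => joinMap a b c +
      (ε • (decomposable (a 1) (b 1) (c 0) + decomposable (a 1) (b 0) (c 1) +
        decomposable (a 0) (b 1) (c 1)) + ε ^ 2 • decomposable (a 1) (b 1) (c 1))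
    have hγ : Continuous γ := by fun_prop
    have hγ0 : γ 0 = joinMap a b c := by simp [γ]
    have htend : Tendsto γ (𝓝[≠] 0) (𝓝 (joinMap a b c)) :=
      hγ0 ▸ (hγ.tendsto 0).mono_left nhdsWithin_le_nhds
    refine htend.frequently (Eventually.frequently ?_)
    have hdet : ∀ᶠ w in 𝓝 (joinMap a b c), (slice w 0).det ≠ 0 :=
      (continuous_slice 0).matrix_det.continuousAt.eventually_ne hA
    filter_upwards [htend.eventually hdet, self_mem_nhdsWithin] with ε h1 hε
    exact isLeast_of_det_ne_zero 1 0 (by simpa using h1) (isSumOfDecomposables_joinMap_add hε) le_rfl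
  · exact not_isSumOfDecomposables_joinMap hA hc ha
      (mk_mem_interior_hasRank.1 hint).self_of_nhds.1

theorem ofReal_joinMap (a : Fin (m + 2) → Fin 2 → ℝ) (b c : Fin (m + 2) → Fin (m + 2) → ℝ) :
    (fun i => ((joinMap a b c i : ℝ) : ℂ)) = joinMap (fun k i => (a k i : ℂ))
      (fun k i => (b k i : ℂ)) (fun k i => (c k i : ℂ)) := by
  ext ⟨l, i, j⟩
  rw [joinMap_apply, joinMap_apply]
  push_cast
  rfl

theorem exists_joinMap_generic : ∃ (a : Fin (m + 2) → Fin 2 → K)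
    (b c : Fin (m + 2) → Fin (m + 2) → K), (slice (joinMap a b c) 0).det ≠ 0 ∧
      (Matrix.of c).det ≠ 0 ∧ a 0 0 * a 1 1 - a 0 1 * a 1 0 ≠ 0 := by
  classical
  -- Swapping the first two vectors of `c` matches the crossed indices of a Jordan block, so the
  -- first slice is the identity.
  refine ⟨fun k => if k = 1 then ![0, 1] else ![1, 0], fun k => Pi.single k 1,
    fun k => Pi.single (Equiv.swap 0 1 k) 1, ?_, ?_, by simp⟩
  · have h1 : ∀ a (b c : Fin (m + 2) → Fin (m + 2) → K), slice (joinMap a b c) 0 = 1 →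
        (slice (joinMap a b c) 0).det ≠ 0 := fun a b c h => by rw [h, Matrix.det_one]; exact one_ne_zero
    refine h1 _ _ _ ?_
    have hss : ∀ k : Fin m, k.succ.succ ≠ 1 := fun k => by
      rw [← Fin.succ_zero_eq_one]
      exact fun h => Fin.succ_ne_zero k (Fin.succ_injective _ h)
    ext i j
    have h2 : (1 : Matrix (Fin (m + 2)) (Fin (m + 2)) K) i j =
        ∑ k, (Pi.single k 1 : Fin (m + 2) → K) i * (Pi.single k 1 : Fin (m + 2) → K) j := by
      simp [Pi.single_apply, Matrix.one_apply]
    rw [h2, Fin.sum_univ_succ, Fin.sum_univ_succ, slice_apply, joinMap_apply]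
    simp [hss, Equiv.swap_apply_of_ne_of_ne]
    ring
  · have h1 : Matrix.of (fun k => (Pi.single (Equiv.swap 0 1 k) 1 : Fin (m + 2) → K)) =
        (1 : Matrix (Fin (m + 2)) (Fin (m + 2)) K).submatrix (Equiv.swap 0 1) id := by
      ext i j
      simp [Pi.single_apply, Matrix.one_apply, eq_comm]
    rw [h1, Matrix.det_permute, Matrix.det_one, mul_one]
    rcases Int.units_eq_one_or (Equiv.Perm.sign (Equiv.swap (0 : Fin (m + 2)) 1)) with h | h <;>
      simp [h]

end JoinMap

/-! ### The two inclusions for the real rank boundary. -/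

section Main

/-- The topological boundary of the real rank `n` locus. -/
def rankBoundary (n : ℕ) : Set (ℙ ℝ (TensorIndex n → ℝ)) :=
  closure {f | HasRank (segre ℝ n) f n} \ interior {f | HasRank (segre ℝ n) f n}

/-- An equation of the boundary vanishes at the generic real parameters, and these are Zariski dense
among the complex ones. -/
theorem joinMap_mem_zariskiClosure {m : ℕ} (a : Fin (m + 2) → Fin 2 → ℂ)
    (b c : Fin (m + 2) → Fin (m + 2) → ℂ) :
    joinMap a b c ∈ affineCone (zariskiClosure (toComplex '' rankBoundary (m + 2))) := by
  intro hne
  refine mk_mem_zariskiClosure.2 fun F d hF hvan => ?_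
  let σ := Fin (m + 2) × (Fin 2 ⊕ Fin (m + 2) ⊕ Fin (m + 2))
  let φ : (σ → ℂ) → TensorIndex (m + 2) → ℂ := fun x =>
    joinMap (fun k i => x (k, .inl i)) (fun k i => x (k, .inr (.inl i)))
      (fun k i => x (k, .inr (.inr i)))
  have hφ : ∀ i, IsPolyFun (fun x => φ x i) := by
    rintro ⟨l, i, j⟩
    simp only [φ, joinMap_apply]
    exact .add (.add (.add (.mul (.mul (.coord _) (.coord _)) (.coord _))
      (.mul (.mul (.coord _) (.coord _)) (.coord _))) (.mul (.mul (.coord _) (.coord _)) (.coord _)))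
      (.sum fun k _ => .mul (.mul (.coord _) (.coord _)) (.coord _))
  let g : (σ → ℂ) → ℂ := fun x => (slice (φ x) 0).det *
    (Matrix.of fun k i => x (k, .inr (.inr i))).det *
      (x (0, .inl 0) * x (1, .inl 1) - x (0, .inl 1) * x (1, .inl 0))
  have hg : IsPolyFun g :=
    .mul (.mul (.det fun i j => hφ (0, i, j)) (.det fun i j => .coord _))
      (.sub (.mul (.coord _) (.coord _)) (.mul (.coord _) (.coord _)))
  have hg0 : ∃ x, g x ≠ 0 := by
    obtain ⟨a, b, c, h1, h2, h3⟩ := exists_joinMap_generic (K := ℂ) (m := m)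
    exact ⟨fun p => Sum.elim (a p.1) (Sum.elim (b p.1) (c p.1)) p.2,
      mul_ne_zero (mul_ne_zero h1 h2) h3⟩
  have hreal : ∀ x : σ → ℝ, g (fun i => (x i : ℂ)) ≠ 0 →
      MvPolynomial.eval (φ fun i => (x i : ℂ)) F = 0 := by
    intro x hx
    have e := ofReal_joinMap (fun k i => x (k, .inl i)) (fun k i => x (k, .inr (.inl i)))
      (fun k i => x (k, .inr (.inr i)))
    have hφx : (φ fun i => (x i : ℂ)) = fun i => ((joinMap (fun k i => x (k, .inl i))
      (fun k i => x (k, .inr (.inl i))) (fun k i => x (k, .inr (.inr i))) i : ℝ) : ℂ) := e.symm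
    obtain ⟨⟨h1, h2⟩, h3⟩ := mul_ne_zero_iff.1 hx |>.imp_left mul_ne_zero_iff.1
    obtain ⟨hv, hmem⟩ := joinMap_mem_boundary (a := fun k i => x (k, .inl i))
      (b := fun k i => x (k, .inr (.inl i))) (c := fun k i => x (k, .inr (.inr i)))
      (fun h => h1 (by
        have := RingHom.map_det Complex.ofRealHom (slice (joinMap (fun k i => x (k, .inl i))
          (fun k i => x (k, .inr (.inl i))) (fun k i => x (k, .inr (.inr i)))) 0)
        rw [h, map_zero] at this
        rw [hφx]
        exact this.symm))
      (fun h => h2 (by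
        have := RingHom.map_det Complex.ofRealHom (Matrix.of fun k i => x (k, .inr (.inr i)))
        rw [h, map_zero] at this
        exact this.symm))
      (fun h => h3 (by beta_reduce; exact_mod_cast h))
    rw [hφx]
    exact (eval_toComplex_rep hF _ hv).1 (hvan _ ⟨_, hmem, rfl⟩)
  exact (IsPolyFun.comp F hφ).eq_zero_of_real_generic hg hreal hg0
    (fun p => Sum.elim (a p.1) (Sum.elim (b p.1) (c p.1)) p.2)

theorem rankBoundary_nonempty (m : ℕ) : (rankBoundary (m + 2)).Nonempty := by
  obtain ⟨a, b, c, h1, h2, h3⟩ := exists_joinMap_generic (K := ℝ) (m := m)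
  obtain ⟨hv, hmem⟩ := joinMap_mem_boundary h1 h2 h3
  exact ⟨_, hmem⟩

theorem join_subset_zariskiClosure_rankBoundary (m : ℕ) :
    join (tangentialVariety (segre ℂ (m + 2))) (secantVariety m (segre ℂ (m + 2))) ⊆
      zariskiClosure (toComplex '' rankBoundary (m + 2)) := by
  refine join_zariskiClosure_subset (Y := tangentPoints (m + 2)) (Z := secantPoints ℂ (m + 2) m)
    ((rankBoundary_nonempty m).image _) fun y hy z hz => ?_
  obtain ⟨a, a', b, b', c, c', rfl⟩ := exists_eq_tangentVec_of_mem_affineCone hy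
  obtain ⟨p, q, r, rfl⟩ := mem_affineCone_secantPoints_iff.1 hz
  exact joinMap_mem_zariskiClosure (Fin.cons a (Fin.cons a' p)) (Fin.cons b (Fin.cons b' q))
    (Fin.cons c (Fin.cons c' r))

theorem zariskiClosure_rankBoundary_subset_join {n : ℕ} (hn : 2 ≤ n) :
    zariskiClosure (toComplex '' rankBoundary n) ⊆
      join (tangentialVariety (segre ℂ n)) (secantVariety (n - 2) (segre ℂ n)) := by
  refine zariskiClosure_subset ?_
  rintro _ ⟨f, ⟨hcl, hint⟩, rfl⟩
  induction f with | h v hv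
  obtain ⟨Q, Z, S, T, hS, hT, h0, h1, i, j, hij, hST⟩ :=
    exists_degenerate_of_mem_boundary hn hcl hint
  obtain ⟨hv', e⟩ := toComplex_mk v hv
  have hvs : (fun i => (v i : ℂ)) = ofSlices (Q * S * Z) (Q * T * Z) := by
    rw [← h0, ← h1]
    ext ⟨l, j, k⟩
    fin_cases l <;> rfl
  have hmem : ofSlices (Q * S * Z) (Q * T * Z) ∈
      affineCone (join (tangentialVariety (segre ℂ n)) (secantVariety (n - 2) (segre ℂ n))) := by
    -- Proportionality must be put as one diagonal pair being `κ` times the other; when the `i`-th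
    -- pair is zero, the roles are exchanged and `κ = 0`.
    by_cases hSi : S i i = 0
    · by_cases hTi : T i i = 0
      · exact ofSlices_mem_join hS hT hij.symm (κ := 0) (by simp [hSi]) (by simp [hTi])
      · have hSj : S j j = 0 := by simpa [hSi, hTi] using hST
        exact ofSlices_mem_join hS hT hij (κ := T j j / T i i) (by simp [hSi, hSj])
          (by rw [div_mul_cancel₀ _ hTi])
    · refine ofSlices_mem_join hS hT hij (κ := S j j / S i i) (by rw [div_mul_cancel₀ _ hSi]) ?_
      field_simp
      linear_combination hST
  rw [e]
  exact (hvs ▸ hmem) hv'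

end Main

end

end RealRank

theorem mainTheorem6 (n : ℕ) (hn : 2 ≤ n) :
    RealRank.IsGenericRank (RealRank.segre ℂ n) n ∧
    (∀ s : ℕ, RealRank.IsTypicalRank (RealRank.segre ℝ n) s ↔ s = n ∨ s = n + 1) ∧
    RealRank.realRankBoundary (RealRank.segre ℝ n) =
      RealRank.join (RealRank.tangentialVariety (RealRank.segre ℂ n))
        (RealRank.secantVariety (n - 2) (RealRank.segre ℂ n)) := by
  refine ⟨RealRank.isGenericRank_segre n, RealRank.isTypicalRank_segre_iff hn, ?_⟩
  rw [RealRank.realRankBoundary, RealRank.genericRankLocus_segre hn]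
  refine Set.Subset.antisymm (RealRank.zariskiClosure_rankBoundary_subset_join hn) ?_
  obtain ⟨m, rfl⟩ := Nat.exists_eq_add_of_le' hn
  exact RealRank.join_subset_zariskiClosure_rankBoundary m
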